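/- Let $M$ be a smooth $n$-dimensional manifold, let $\alpha=\sqrt{a_{ij}(x)y^iy^j}$ be a (smooth) Riemannian metric and $\beta=b_i(x)y^i$ a (smooth) $1$-form on $M$ with $\|\beta\|_\alpha<1$ at every point, and suppose that $$F=\frac{(\alpha+\beta)^2}{\alpha}$$ (with $F=0$ on zero vectors) is a Finsler metric on $M$, i.e. $F$ is continuous and nonnegative on $TM$, smooth on $TM\setminus\{0\}$, positively homogeneous of degree one in $y$, and its fundamental tensor $g_{ij}=[\tfrac12F^2]_{y^iy^j}$ is positive definite for $y\neq 0$. Here $\|\beta\|_\alpha(x)=\sup_{y\in T_xM\setminus\{0\}}\beta(x,y)/\alpha(x,y)$. A Finsler (in particular, a Riemannian) metric is called locally projectively flat if around every point there is a local coordinate system in which all its geodesics, i.e. the solutions of $\ddot c^i+2G^i(c,\dot c)=0$ with $\dot c\neq0$, where $G^i=\tfrac14 g^{il}\{[F^2]_{x^ky^l}y^k-[F^2]_{x^l}\}$, are straight lines as point sets. A $1$-form $\beta$ is called conformal with respect to a Riemannian metric $\alpha$ if its covariant derivative $b_{i|j}$ with respect to $\alpha$ satisfies $\tfrac12(b_{i|j}+b_{j|i})=c(x)\,a_{ij}$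 for some scalar function $c$ on $M$. Then $F$ is locally projectively flat if and only if there exist on $M$ a locally projectively flat Riemannian metric $\bar\alpha$ and a closed $1$-form $\bar\beta$ that is conformal with respect to $\bar\alpha$ such that, with $\bar b:=\|\bar\beta\|_{\bar\alpha}$, $$\alpha=(1+\bar b^2)\,\bar\alpha,\qquad \beta=\sqrt{1+\bar b^2}\;\bar\beta .$$ Moreover, for any such $\bar\alpha$ and $\bar\beta$, $$F=\frac{\left(\sqrt{1+\bar b^2}\,\bar\alpha+\bar\beta\right)^2}{\bar\alpha}.$$ -/

import Mathlib

open scoped Manifold ContDiff Topology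

noncomputable section

namespace Berwald

/-- The model space of coordinates `ℝⁿ`. -/
abbrev Coord (n : ℕ) : Type := EuclideanSpace ℝ (Fin n)

/-! ### Finsler geometry in a coordinate domain

A Finsler function in coordinates is a function `F x y` of the coordinates `x` of the point and
the coordinates `y` of the tangent vector; a metric tensor is a matrix-valued function of `x`, and
a 1-form is a vector-valued function of `x`. -/

section Coordinates

variable {n : ℕ}

/-- The `i`-th partial derivative of `f : ℝⁿ → ℝ` at `x`. -/
def partialDeriv (i : Fin n) (f : Coord n → ℝ) (x : Coord n) : ℝ :=
  fderiv ℝ f x (EuclideanSpace.single i 1)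

/-- The fundamental tensor `g_ij = [½ F²]_{yⁱ yʲ}`. -/
def fundamentalTensor (F : Coord n → Coord n → ℝ) (x y : Coord n) :
    Matrix (Fin n) (Fin n) ℝ :=
  Matrix.of fun i j =>
    partialDeriv j (fun w => partialDeriv i (fun z => (1 / 2 : ℝ) * F x z ^ 2) w) y

/-- The spray coefficients
`Gⁱ(x, y) = ¼ ∑ₗ gⁱˡ { ∑ₖ [F²]_{xᵏ yˡ} yᵏ - [F²]_{xˡ} }`. -/
def sprayCoeff (F : Coord n → Coord n → ℝ) (x y : Coord n) (i : Fin n) : ℝ :=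
  (1 / 4 : ℝ) * ∑ l : Fin n, (fundamentalTensor F x y)⁻¹ i l *
    ((∑ k : Fin n,
        partialDeriv l (fun w => partialDeriv k (fun z => F z w ^ 2) x) y * y k)
      - partialDeriv l (fun z => F z y ^ 2) x)

/-- `c` is, on the set of times `J`, a (regular) geodesic of `F` inside the coordinate domain `U`:
`c̈ⁱ + 2 Gⁱ(c, ċ) = 0`. -/
def IsGeodesicOn (F : Coord n → Coord n → ℝ) (U : Set (Coord n)) (J : Set ℝ)
    (c : ℝ → Coord n) : Prop :=
  ∃ v : ℝ → Coord n, ∀ t ∈ J,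
    c t ∈ U ∧ v t ≠ 0 ∧ HasDerivAt c (v t) t ∧
      HasDerivAt v (WithLp.toLp 2 fun i => -2 * sprayCoeff F (c t) (v t) i) t

/-- All geodesics of `F` inside the coordinate domain `U` are straight lines (as point sets). -/
def GeodesicsAreStraight (F : Coord n → Coord n → ℝ) (U : Set (Coord n)) : Prop :=
  ∀ (J : Set ℝ) (c : ℝ → Coord n), IsOpen J → J.OrdConnected →
    IsGeodesicOn F U J c → Collinear ℝ (c '' J)

/-- The Christoffel symbols
`Γᵏ_ij = ½ ∑ₗ aᵏˡ (∂ᵢ a_jl + ∂ⱼ a_il - ∂ₗ a_ij)` of the metric tensor `a`. -/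
def christoffel (a : Coord n → Matrix (Fin n) (Fin n) ℝ) (x : Coord n) (k i j : Fin n) : ℝ :=
  (1 / 2 : ℝ) * ∑ l : Fin n, (a x)⁻¹ k l *
    (partialDeriv i (fun z => a z j l) x + partialDeriv j (fun z => a z i l) x
      - partialDeriv l (fun z => a z i j) x)

/-- The covariant derivative `b_{i|j} = ∂b_i/∂xʲ - ∑ₖ b_k Γᵏ_ij` of the 1-form `b`. -/
def covDeriv (a : Coord n → Matrix (Fin n) (Fin n) ℝ) (b : Coord n → Fin n → ℝ)
    (x : Coord n) (i j : Fin n) : ℝ :=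
  partialDeriv j (fun z => b z i) x - ∑ k : Fin n, b x k * christoffel a x k i j

end Coordinates

/-! ### Objects on a manifold -/

section Manifold

variable (n : ℕ) (M : Type*) [TopologicalSpace M] [ChartedSpace (Coord n) M]
  [IsManifold (𝓡 n) ∞ M]

/-- Smooth Riemannian metrics on `M`. -/
abbrev RiemMetric : Type _ :=
  Bundle.ContMDiffRiemannianMetric (𝓡 n) ∞ (Coord n)
    (fun x : M => TangentSpace (𝓡 n) x)

/-- Smooth 1-forms on `M`, that is, smooth sections of the cotangent bundle. -/
abbrev OneForm : Type _ :=
  ContMDiffSection (𝓡 n) (Coord n →L[ℝ] ℝ) ∞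
    (fun x : M => TangentSpace (𝓡 n) x →L[ℝ] Bundle.Trivial M ℝ x)

variable {n M}

/-- The value `β(x, y) = b_i(x) yⁱ` of a 1-form on a tangent vector. -/
def OneForm.val (β : OneForm n M) (x : M) (y : TangentSpace (𝓡 n) x) : ℝ := β x y

/-- The function `α(x, y) = √(a_ij(x) yⁱ yʲ)` on tangent vectors defined by a Riemannian metric. -/
def RiemMetric.val (α : RiemMetric n M) (x : M) (y : TangentSpace (𝓡 n) x) : ℝ :=
  Real.sqrt (α.inner x y y)

/-- The norm `‖β‖_α = sup_y β(x, y) / α(x, y)`. The vector `y = 0` contributes the value `0`,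
which does not change the supremum over the nonzero vectors. -/
def dualNorm (α : RiemMetric n M) (β : OneForm n M) (x : M) : ℝ :=
  ⨆ y : TangentSpace (𝓡 n) x, β.val x y / α.val x y

/-- The tangent vector at the point with coordinates `u` whose components in the chart `e` are `v`.
It is meaningful for `u ∈ e.target`. -/
def chartVector (e : OpenPartialHomeomorph M (Coord n)) (u v : Coord n) :
    TangentSpace (𝓡 n) (e.symm u) :=
  mfderiv (𝓡 n) (𝓡 n) e.symm u v

/-- The coordinate expression of a function on the tangent bundle. -/
def inChart (F : ∀ x : M, TangentSpace (𝓡 n) x → ℝ)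
    (e : OpenPartialHomeomorph M (Coord n)) (u v : Coord n) : ℝ :=
  F (e.symm u) (chartVector e u v)

/-- The components `a_ij` of a Riemannian metric in a chart. -/
def RiemMetric.comp (α : RiemMetric n M) (e : OpenPartialHomeomorph M (Coord n))
    (u : Coord n) : Matrix (Fin n) (Fin n) ℝ :=
  Matrix.of fun i j =>
    α.inner (e.symm u) (chartVector e u (EuclideanSpace.single i 1))
      (chartVector e u (EuclideanSpace.single j 1))

/-- The components `b_i` of a 1-form in a chart. -/
def OneForm.comp (β : OneForm n M) (e : OpenPartialHomeomorph M (Coord n))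
    (u : Coord n) (i : Fin n) : ℝ :=
  β.val (e.symm u) (chartVector e u (EuclideanSpace.single i 1))

/-- Finsler metrics on `M`: continuous nonnegative functions on `TM` that are smooth on the slit
tangent bundle, positively homogeneous and strongly convex. -/
structure IsFinsler (F : ∀ x : M, TangentSpace (𝓡 n) x → ℝ) : Prop where
  continuous : Continuous fun p : TangentBundle (𝓡 n) M => F p.1 p.2
  nonneg : ∀ (x : M) (y : TangentSpace (𝓡 n) x), 0 ≤ F x y
  regular : ContMDiffOn (𝓡 n).tangent 𝓘(ℝ, ℝ) ∞
    (fun p : TangentBundle (𝓡 n) M => F p.1 p.2) {p | p.2 ≠ 0}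
  homogeneous : ∀ (x : M) (y : TangentSpace (𝓡 n) x) (r : ℝ), 0 < r → F x (r • y) = r * F x y
  convex : ∀ e ∈ IsManifold.maximalAtlas (𝓡 n) ∞ M, ∀ u ∈ e.target, ∀ v : Coord n, v ≠ 0 →
    (fundamentalTensor (inChart F e) u v).PosDef

/-- `F` is locally projectively flat: around every point there is a local coordinate system in
which all geodesics of `F` are straight lines. -/
def IsLocallyProjectivelyFlat (F : ∀ x : M, TangentSpace (𝓡 n) x → ℝ) : Prop :=
  ∀ p : M, ∃ e ∈ IsManifold.maximalAtlas (𝓡 n) ∞ M, p ∈ e.source ∧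
    GeodesicsAreStraight (inChart F e) e.target

/-- `β` is closed: `∂b_i/∂xʲ = ∂b_j/∂xⁱ` in every chart. -/
def OneForm.IsClosed (β : OneForm n M) : Prop :=
  ∀ e ∈ IsManifold.maximalAtlas (𝓡 n) ∞ M, ∀ u ∈ e.target, ∀ i j : Fin n,
    partialDeriv j (fun z => β.comp e z i) u = partialDeriv i (fun z => β.comp e z j) u

/-- `β` is conformal with respect to `α`: the symmetrization `r_ij = ½ (b_{i|j} + b_{j|i})` of its
covariant derivative is `c(x) a_ij` for a scalar function `c`; equivalently, the dual vector field
is conformal. -/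
def OneForm.IsConformal (β : OneForm n M) (α : RiemMetric n M) : Prop :=
  ∃ c : M → ℝ, ∀ e ∈ IsManifold.maximalAtlas (𝓡 n) ∞ M, ∀ u ∈ e.target, ∀ i j : Fin n,
    (1 / 2 : ℝ) * (covDeriv (α.comp e) (β.comp e) u i j + covDeriv (α.comp e) (β.comp e) u j i)
      = c (e.symm u) * α.comp e u i j

/-- Berwald's function `F = (α + β)² / α` (equal to `0` on zero vectors). -/
def berwaldMetric (α : RiemMetric n M) (β : OneForm n M) (x : M)
    (y : TangentSpace (𝓡 n) x) : ℝ :=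
  (α.val x y + β.val x y) ^ 2 / α.val x y

/-- `α = (1 + b̄²) ᾱ` and `β = √(1 + b̄²) β̄` with `b̄ = ‖β̄‖_ᾱ`, where `ᾱ` is locally projectively
flat and `β̄` is closed and conformal with respect to `ᾱ`. -/
structure IsDeformationData (α : RiemMetric n M) (β : OneForm n M)
    (α' : RiemMetric n M) (β' : OneForm n M) : Prop where
  flat : IsLocallyProjectivelyFlat α'.val
  closed : β'.IsClosed
  conformal : β'.IsConformal α'
  alpha_eq : ∀ (x : M) (y : TangentSpace (𝓡 n) x),
    α.val x y = (1 + dualNorm α' β' x ^ 2) * α'.val x y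
  beta_eq : ∀ (x : M) (y : TangentSpace (𝓡 n) x),
    β.val x y = Real.sqrt (1 + dualNorm α' β' x ^ 2) * β'.val x y

end Manifold

end Berwald

end

open scoped Manifold ContDiff Topology

noncomputable section

namespace Berwald

variable {n : ℕ}

/-! Hamel's criterion (`IsSlitFinsler.geodesicsAreStraight_iff`) turns straightness of geodesics in
a chart into F_{xᵏyˡ}yᵏ = F_{xˡ}. Write b² for the squared norm of β, b^♯ for the dual vector, r for
the symmetrized covariant derivative and T for the projective defect of α.

For F = α + 2β + β²/α, Hamel's equation (`hamel_alphaBeta`) splits by parity in y. The odd part says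
that β is closed. The even part, combined with its contraction with b^♯, becomes D·T(w) + 2α²
r(y,y)(α² β(w) − β(y) a(y,w)) = 0, with D = (1 + 2b²)α² − 3β² (`hamel_split`). On a line y = z b^♯ +
q with β(q) = 0, the quadratics D and α² are coprime in z, so D divides r(y,y). Hence r = τ((1 +
2b²)a − 3b⊗b) (`covSym_proportional_of_ne_zero`); zeros of β are handled by continuity
(`exists_covSym_eq`).

It follows that d(b²) = 2τ(1 − b²)β and T(w) = −2τα²(α² β(w) − β(y) a(y,w)). These are exactly the
relations under which (1 − b²)α satisfies Hamel's equation and √(1 − b²)β is closed and conformal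
for it (`deformation_of_hamel`). The new norm satisfies 1 + b̄² = 1/(1 − b²), so the deformation
inverts α = (1 + b̄²)ᾱ, β = √(1 + b̄²)β̄.

Conversely, in a chart straightening ᾱ, d(b̄²) = 2cβ̄ makes Hamel's expression for F cancel
(`hamel_of_deformation`). The deformed objects are global because the norm is intrinsic; closedness
and conformality pass from one chart to all by tensoriality. -/

/-- The left-hand side `F_{xᵏ yˡ} yᵏ wˡ - F_{xˡ} wˡ` of Hamel's equation. -/
def hamel (F : Coord n → Coord n → ℝ) (x y w : Coord n) : ℝ :=
  fderiv ℝ (fderiv ℝ (Function.uncurry F)) (x, y) (y, 0) (0, w)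
    - fderiv ℝ (Function.uncurry F) (x, y) (w, 0)

/-- Smooth positive functions on a slit coordinate domain which are homogeneous of degree one and
have an invertible fundamental tensor. -/
structure IsSlitFinsler (F : Coord n → Coord n → ℝ) (U : Set (Coord n)) : Prop where
  isOpen : IsOpen U
  smooth : ContDiffOn ℝ ∞ (Function.uncurry F) (U ×ˢ {0}ᶜ)
  pos : ∀ x ∈ U, ∀ y ≠ 0, 0 < F x y
  homogeneous : ∀ x ∈ U, ∀ y : Coord n, ∀ r : ℝ, 0 < r → F x (r • y) = r * F x y
  isUnit_det : ∀ x ∈ U, ∀ y ≠ 0, IsUnit (fundamentalTensor F x y).det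

theorem eventually_slit {U : Set (Coord n)} (hU : IsOpen U) {p : Coord n × Coord n}
    (hx : p.1 ∈ U) (hy : p.2 ≠ 0) : U ×ˢ {0}ᶜ ∈ 𝓝 p :=
  (hU.prod isOpen_compl_singleton).mem_nhds ⟨hx, hy⟩

theorem sum_smul_single (w : Coord n) :
    ∑ i, w i • (EuclideanSpace.single i (1 : ℝ) : Coord n) = w := by
  ext j
  simp [Finset.sum_apply, Pi.single_apply]

/-- A linear function is determined by its values on the coordinate vectors. -/
theorem clm_eq_sum (L : Coord n →L[ℝ] ℝ) (w : Coord n) :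
    L w = ∑ i, w i * L (EuclideanSpace.single i 1) := by
  conv_lhs => rw [← sum_smul_single w]
  simp

/-! ### Iterated coordinate partials as Fréchet derivatives. -/

section Partial

variable {f : Coord n × Coord n → ℝ} {x y : Coord n}

theorem hasFDerivAt_slice_left (hf : DifferentiableAt ℝ f (x, y)) :
    HasFDerivAt (fun z => f (z, y)) ((fderiv ℝ f (x, y)).comp (.inl ℝ _ _)) x :=
  hf.hasFDerivAt.comp x (hasFDerivAt_prodMk_left x y)

theorem hasFDerivAt_slice_right (hf : DifferentiableAt ℝ f (x, y)) :
    HasFDerivAt (fun z => f (x, z)) ((fderiv ℝ f (x, y)).comp (.inr ℝ _ _)) y :=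
  hf.hasFDerivAt.comp y (hasFDerivAt_prodMk_right x y)

theorem partialDeriv_left (hf : DifferentiableAt ℝ f (x, y)) (k : Fin n) :
    partialDeriv k (fun z => f (z, y)) x = fderiv ℝ f (x, y) (EuclideanSpace.single k 1, 0) := by
  simp [partialDeriv, (hasFDerivAt_slice_left hf).fderiv]

theorem partialDeriv_right (hf : DifferentiableAt ℝ f (x, y)) (k : Fin n) :
    partialDeriv k (fun z => f (x, z)) y = fderiv ℝ f (x, y) (0, EuclideanSpace.single k 1) := by
  simp [partialDeriv, (hasFDerivAt_slice_right hf).fderiv]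

theorem differentiableAt_of_contDiffAt (hf : ContDiffAt ℝ ∞ f (x, y)) :
    DifferentiableAt ℝ f (x, y) := hf.differentiableAt (by simp)

theorem contDiffAt_fderiv (hf : ContDiffAt ℝ ∞ f (x, y)) : ContDiffAt ℝ ∞ (fderiv ℝ f) (x, y) :=
  hf.fderiv_right (by simp)

theorem fderiv_fderiv_apply (hf : ContDiffAt ℝ ∞ f (x, y)) (v w : Coord n × Coord n) :
    fderiv ℝ (fun p => fderiv ℝ f p v) (x, y) w = fderiv ℝ (fderiv ℝ f) (x, y) w v := by
  have := (contDiffAt_fderiv hf).differentiableAt (by simp)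
  rw [fderiv_clm_apply this (by fun_prop)]
  simp

theorem eventually_contDiffAt (hf : ContDiffAt ℝ ∞ f (x, y)) :
    ∀ᶠ p in 𝓝 (x, y), DifferentiableAt ℝ f p := by
  have h1 : ContDiffAt ℝ 1 f (x, y) := hf.of_le (by norm_cast)
  filter_upwards [h1.eventually (by simp)] with p hp
  exact hp.differentiableAt (by simp)

theorem differentiableAt_fderiv_apply (hf : ContDiffAt ℝ ∞ f (x, y)) (v : Coord n × Coord n) :
    DifferentiableAt ℝ (fun p => fderiv ℝ f p v) (x, y) :=
  ((contDiffAt_fderiv hf).differentiableAt (by simp)).clm_apply (by fun_prop)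

theorem partialDeriv_right_left (hf : ContDiffAt ℝ ∞ f (x, y)) (k l : Fin n) :
    partialDeriv l (fun w => partialDeriv k (fun z => f (z, w)) x) y =
      fderiv ℝ (fderiv ℝ f) (x, y) (0, EuclideanSpace.single l 1)
        (EuclideanSpace.single k 1, 0) := by
  have hev : (fun w => partialDeriv k (fun z => f (z, w)) x) =ᶠ[𝓝 y]
      fun w => fderiv ℝ f (x, w) (EuclideanSpace.single k 1, 0) := by
    have hc : Filter.Tendsto (fun w : Coord n => (x, w)) (𝓝 y) (𝓝 (x, y)) :=
      Continuous.tendsto (by fun_prop) y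
    filter_upwards [hc.eventually (eventually_contDiffAt hf)] with w hw
    exact partialDeriv_left hw k
  have h2 : partialDeriv l (fun w => partialDeriv k (fun z => f (z, w)) x) y =
      partialDeriv l (fun w => fderiv ℝ f (x, w) (EuclideanSpace.single k 1, 0)) y := by
    unfold partialDeriv at *
    rw [hev.fderiv_eq]
  rw [h2, partialDeriv_right (f := fun p => fderiv ℝ f p (EuclideanSpace.single k 1, 0))
    (differentiableAt_fderiv_apply hf _), fderiv_fderiv_apply hf]

theorem partialDeriv_right_right (hf : ContDiffAt ℝ ∞ f (x, y)) (k l : Fin n) :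
    partialDeriv l (fun w => partialDeriv k (fun z => f (x, z)) w) y =
      fderiv ℝ (fderiv ℝ f) (x, y) (0, EuclideanSpace.single l 1)
        (0, EuclideanSpace.single k 1) := by
  have hev : (fun w => partialDeriv k (fun z => f (x, z)) w) =ᶠ[𝓝 y]
      fun w => fderiv ℝ f (x, w) (0, EuclideanSpace.single k 1) := by
    have hc : Filter.Tendsto (fun w : Coord n => (x, w)) (𝓝 y) (𝓝 (x, y)) :=
      Continuous.tendsto (by fun_prop) y
    filter_upwards [hc.eventually (eventually_contDiffAt hf)] with w hw
    exact partialDeriv_right hw k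
  have h2 : partialDeriv l (fun w => partialDeriv k (fun z => f (x, z)) w) y =
      partialDeriv l (fun w => fderiv ℝ f (x, w) (0, EuclideanSpace.single k 1)) y := by
    unfold partialDeriv at *
    rw [hev.fderiv_eq]
  rw [h2, partialDeriv_right (f := fun p => fderiv ℝ f p (0, EuclideanSpace.single k 1))
    (differentiableAt_fderiv_apply hf _), fderiv_fderiv_apply hf]

theorem fderiv_sq (hf : DifferentiableAt ℝ f (x, y)) (v : Coord n × Coord n) :
    fderiv ℝ (fun p => f p ^ 2) (x, y) v = 2 * f (x, y) * fderiv ℝ f (x, y) v := by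
  have := (hf.hasFDerivAt.pow 2).fderiv
  rw [this]
  simp

theorem fderiv_fderiv_sq (hf : ContDiffAt ℝ ∞ f (x, y)) (v w : Coord n × Coord n) :
    fderiv ℝ (fderiv ℝ (fun p => f p ^ 2)) (x, y) w v =
      2 * fderiv ℝ f (x, y) w * fderiv ℝ f (x, y) v
        + 2 * f (x, y) * fderiv ℝ (fderiv ℝ f) (x, y) w v := by
  have hev : (fun p => fderiv ℝ (fun p => f p ^ 2) p v) =ᶠ[𝓝 (x, y)]
      fun p => 2 * f p * fderiv ℝ f p v := by
    filter_upwards [eventually_contDiffAt hf] with p hp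
    exact fderiv_sq hp v
  rw [← fderiv_fderiv_apply (hf.pow 2), hev.fderiv_eq]
  have h1 := ((differentiableAt_of_contDiffAt hf).hasFDerivAt.const_mul 2).mul
    (differentiableAt_fderiv_apply hf v).hasFDerivAt
  rw [show (fun p => 2 * f p * fderiv ℝ f p v) = (fun p => 2 * f p) * fun p => fderiv ℝ f p v
    from rfl, h1.fderiv]
  simp [fderiv_fderiv_apply hf]
  ring

end Partial

theorem partialDeriv_const_mul (k : Fin n) (c : ℝ) (f : Coord n → ℝ) (x : Coord n) :
    partialDeriv k (fun z => c * f z) x = c * partialDeriv k f x := by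
  rw [partialDeriv, show (fun z => c * f z) = c • f from rfl, fderiv_const_smul_field]
  rfl

/-! ### Euler's identities and the spray. -/

section Euler

variable {F : Coord n → Coord n → ℝ} {U : Set (Coord n)}

namespace IsSlitFinsler

theorem contDiffAt (h : IsSlitFinsler F U) {x y : Coord n} (hx : x ∈ U) (hy : y ≠ 0) :
    ContDiffAt ℝ ∞ (Function.uncurry F) (x, y) :=
  h.smooth.contDiffAt (eventually_slit h.isOpen hx hy)

/-- Differentiate r ↦ F(x, r y) at r = 1, once by the chain rule and once by homogeneity. -/
theorem euler (h : IsSlitFinsler F U) {x y : Coord n} (hx : x ∈ U) (hy : y ≠ 0) :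
    fderiv ℝ (Function.uncurry F) (x, y) (0, y) = F x y := by
  have hd : HasDerivAt (fun r : ℝ => F x (r • y)) (fderiv ℝ (Function.uncurry F) (x, y) (0, y)) 1 := by
    have h1 : HasDerivAt (fun r : ℝ => (x, r • y)) ((0 : Coord n), y) 1 := by
      have := (hasDerivAt_const (1 : ℝ) x).prodMk ((hasDerivAt_id (1 : ℝ)).smul_const y)
      simpa using this
    have h2 : HasFDerivAt (Function.uncurry F) (fderiv ℝ (Function.uncurry F) (x, y))
        (x, (1 : ℝ) • y) := by
      simpa using (differentiableAt_of_contDiffAt (h.contDiffAt hx hy)).hasFDerivAt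
    exact h2.comp_hasDerivAt (1 : ℝ) h1
  have hd' : HasDerivAt (fun r : ℝ => F x (r • y)) (F x y) 1 := by
    have h1 : HasDerivAt (fun r : ℝ => r * F x y) (1 * F x y) 1 :=
      (hasDerivAt_id (1 : ℝ)).mul_const _
    rw [one_mul] at h1
    refine h1.congr_of_eventuallyEq ?_
    filter_upwards [lt_mem_nhds (zero_lt_one' ℝ)] with r hr
    exact h.homogeneous x hx y r hr
  exact hd.unique hd'

/-- This is the derivative of Euler's identity. A vertical v gives F_{yy} y = 0, and v = (y, 0)
shows that Hamel's covector kills y. -/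
theorem fderiv_euler (h : IsSlitFinsler F U) {x y : Coord n} (hx : x ∈ U) (hy : y ≠ 0) (v : Coord n × Coord n) :
    fderiv ℝ (fderiv ℝ (Function.uncurry F)) (x, y) v (0, y)
      + fderiv ℝ (Function.uncurry F) (x, y) (0, v.2)
      = fderiv ℝ (Function.uncurry F) (x, y) v := by
  have hc := h.contDiffAt hx hy
  have hev : (fun p : Coord n × Coord n => fderiv ℝ (Function.uncurry F) p (0, p.2)) =ᶠ[𝓝 (x, y)]
      Function.uncurry F := by
    filter_upwards [eventually_slit h.isOpen (p := (x, y)) hx hy] with p hp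
    exact h.euler hp.1 hp.2
  have h1 := ((contDiffAt_fderiv hc).differentiableAt (by simp)).hasFDerivAt.clm_apply
    ((ContinuousLinearMap.inr ℝ (Coord n) (Coord n)).comp
      (ContinuousLinearMap.snd ℝ (Coord n) (Coord n))).hasFDerivAt
  have h2 := h1.fderiv
  have h3 : (fun p : Coord n × Coord n => fderiv ℝ (Function.uncurry F) p
      (((ContinuousLinearMap.inr ℝ (Coord n) (Coord n)).comp
      (ContinuousLinearMap.snd ℝ (Coord n) (Coord n))) p)) = fun p => fderiv ℝ (Function.uncurry F) p (0, p.2) := by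
    ext p; simp
  rw [h3, hev.fderiv_eq] at h2
  have h4 := congrArg (fun L => L v) h2
  simp at h4
  rw [h4]; ring

theorem isSymm (h : IsSlitFinsler F U) {x y : Coord n} (hx : x ∈ U) (hy : y ≠ 0) (v w : Coord n × Coord n) :
    fderiv ℝ (fderiv ℝ (Function.uncurry F)) (x, y) v w =
      fderiv ℝ (fderiv ℝ (Function.uncurry F)) (x, y) w v :=
  ((h.contDiffAt hx hy).isSymmSndFDerivAt (by simp; norm_cast)).eq v w

theorem hamel_self (h : IsSlitFinsler F U) {x y : Coord n} (hx : x ∈ U) (hy : y ≠ 0) : hamel F x y y = 0 := by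
  have := h.fderiv_euler hx hy (y, 0)
  have h0 : ((0 : Coord n), (0 : Coord n)) = 0 := rfl
  simp only [h0, map_zero, add_zero] at this
  rw [hamel, this, sub_self]

/-- The fundamental tensor in terms of the derivatives of `F`. -/
theorem fundamentalTensor_apply (h : IsSlitFinsler F U) {x y : Coord n} (hx : x ∈ U) (hy : y ≠ 0)
    (i j : Fin n) : fundamentalTensor F x y i j =
      fderiv ℝ (Function.uncurry F) (x, y) (0, EuclideanSpace.single j 1)
        * fderiv ℝ (Function.uncurry F) (x, y) (0, EuclideanSpace.single i 1)
      + F x y * fderiv ℝ (fderiv ℝ (Function.uncurry F)) (x, y) (0, EuclideanSpace.single j 1)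
        (0, EuclideanSpace.single i 1) := by
  have hc := h.contDiffAt hx hy
  have h1 := partialDeriv_right_right (hc.pow 2) i j
  rw [fderiv_fderiv_sq hc] at h1
  have h2 : fundamentalTensor F x y i j = (1 / 2) * partialDeriv j
      (fun w => partialDeriv i (fun z => Function.uncurry F (x, z) ^ 2) w) y := by
    simp only [fundamentalTensor, Matrix.of_apply, Function.uncurry_apply_pair,
      partialDeriv_const_mul]
  rw [h2]
  erw [h1]
  simp only [Function.uncurry_apply_pair]
  ring

/-- The covector `g_ij yʲ` is `F F_{yⁱ}`. -/
theorem fundamentalTensor_mulVec (h : IsSlitFinsler F U) {x y : Coord n} (hx : x ∈ U) (hy : y ≠ 0) (i : Fin n) :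
    (fundamentalTensor F x y).mulVec y i =
      F x y * fderiv ℝ (Function.uncurry F) (x, y) (0, EuclideanSpace.single i 1) := by
  have hentry := h.fundamentalTensor_apply hx hy i
  have hs : ∀ L : Coord n × Coord n →L[ℝ] ℝ, ∑ j, L (0, EuclideanSpace.single j 1) * y j = L (0, y) := by
    intro L
    have := clm_eq_sum (L.comp (.inr ℝ _ _)) y
    simp at this
    rw [this]
    exact Finset.sum_congr rfl fun _ _ => mul_comm _ _
  simp only [Matrix.mulVec, dotProduct, hentry, add_mul, Finset.sum_add_distrib]
  have e1 := hs (fderiv ℝ (Function.uncurry F) (x, y))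
  have e2 := hs ((fderiv ℝ (fderiv ℝ (Function.uncurry F)) (x, y)).flip
    (0, EuclideanSpace.single i 1))
  simp only [ContinuousLinearMap.flip_apply] at e2
  have e3 := h.fderiv_euler hx hy (0, EuclideanSpace.single i 1)
  rw [h.isSymm hx hy] at e3
  have e4 : fderiv ℝ (fderiv ℝ (Function.uncurry F)) (x, y) (0, y)
        (0, EuclideanSpace.single i 1) = 0 := by linarith
  rw [e4] at e2
  rw [h.euler hx hy] at e1
  simp only [mul_assoc, ← Finset.mul_sum]
  rw [e2]
  simp only [mul_zero, add_zero]
  rw [← e1, Finset.sum_mul]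
  exact Finset.sum_congr rfl fun _ _ => by ring

/-- The covector whose contraction with `¼ g⁻¹` is the spray. -/
theorem spray_covector (h : IsSlitFinsler F U) {x y : Coord n} (hx : x ∈ U) (hy : y ≠ 0) (l : Fin n) :
    (∑ k : Fin n, partialDeriv l (fun w => partialDeriv k (fun z => F z w ^ 2) x) y * y k)
      - partialDeriv l (fun z => F z y ^ 2) x =
    2 * F x y * hamel F x y (EuclideanSpace.single l 1)
      + 2 * fderiv ℝ (Function.uncurry F) (x, y) (y, 0)
        * fderiv ℝ (Function.uncurry F) (x, y) (0, EuclideanSpace.single l 1) := by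
  have hc := h.contDiffAt hx hy
  have h1 : ∀ k, partialDeriv l (fun w => partialDeriv k (fun z => F z w ^ 2) x) y = _ :=
    fun k => partialDeriv_right_left (hc.pow 2) k l
  have h2 : partialDeriv l (fun z => F z y ^ 2) x = _ :=
    partialDeriv_left (differentiableAt_of_contDiffAt (hc.pow 2)) l
  rw [h2]
  simp only [h1]
  have hs : ∀ L : Coord n × Coord n →L[ℝ] ℝ, ∑ j, L (EuclideanSpace.single j 1, 0) * y j = L (y, 0) := by
    intro L
    have := clm_eq_sum (L.comp (.inl ℝ _ _)) y
    simp at this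
    rw [this]
    exact Finset.sum_congr rfl fun _ _ => mul_comm _ _
  rw [hs]
  have e1 := fderiv_fderiv_sq hc (y, 0) (0, EuclideanSpace.single l 1)
  have e2 := fderiv_sq (differentiableAt_of_contDiffAt hc) (EuclideanSpace.single l 1, 0)
  rw [e1, e2]
  rw [hamel, h.isSymm hx hy (y, 0)]
  simp only [Function.uncurry_apply_pair]
  ring

/-- The map `w ↦ hamel F x y w` as a linear function. -/
theorem hamel_eq_sum (x y w : Coord n) :
    hamel F x y w = ∑ i, w i * hamel F x y (EuclideanSpace.single i 1) := by
  have := clm_eq_sum (((fderiv ℝ (fderiv ℝ (Function.uncurry F)) (x, y) (y, 0)).comp (.inr ℝ _ _))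
    - (fderiv ℝ (Function.uncurry F) (x, y)).comp (.inl ℝ _ _)) w
  simpa [hamel] using this

/-- Since g y = F F_y, the inverse of g sends the F_y part of `spray_covector` to a multiple of y.
Only the Hamel covector can make the spray deviate from the direction of y. -/
theorem sprayCoeff_eq (h : IsSlitFinsler F U) {x y : Coord n} (hx : x ∈ U) (hy : y ≠ 0) :
    sprayCoeff F x y = (F x y / 2) • (fundamentalTensor F x y)⁻¹.mulVec
        (fun l => hamel F x y (EuclideanSpace.single l 1))
      + (fderiv ℝ (Function.uncurry F) (x, y) (y, 0) / (2 * F x y)) • (y : Fin n → ℝ) := by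
  have hF := (h.pos x hx y hy).ne'
  have hy' : (y : Fin n → ℝ) = (fundamentalTensor F x y)⁻¹.mulVec
      ((fundamentalTensor F x y).mulVec y) := by
    rw [Matrix.mulVec_mulVec, Matrix.nonsing_inv_mul _ (h.isUnit_det x hx y hy), Matrix.one_mulVec]
  have h1 : (fundamentalTensor F x y).mulVec y = F x y • fun i =>
      fderiv ℝ (Function.uncurry F) (x, y) (0, EuclideanSpace.single i 1) := by
    ext i; rw [h.fundamentalTensor_mulVec hx hy]; rfl
  rw [hy', h1]
  ext i
  simp only [sprayCoeff, h.spray_covector hx hy, Matrix.mulVec_smul, Pi.add_apply, Pi.smul_apply,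
    smul_eq_mul, Matrix.mulVec, dotProduct, Finset.mul_sum]
  rw [← Finset.sum_add_distrib]
  refine Finset.sum_congr rfl fun l _ => ?_
  field_simp
  ring

/-- The spray is proportional to `y` exactly when Hamel's equation holds. -/
theorem spray_parallel_iff (h : IsSlitFinsler F U) {x y : Coord n} (hx : x ∈ U) (hy : y ≠ 0) :
    (∃ P : ℝ, ∀ i, sprayCoeff F x y i = P * y i) ↔ ∀ w, hamel F x y w = 0 := by
  have hF := h.pos x hx y hy
  constructor
  · rintro ⟨P, hP⟩
    set Q := fderiv ℝ (Function.uncurry F) (x, y) (y, 0) / (2 * F x y) with hQ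
    have h1 : (F x y / 2) • (fundamentalTensor F x y)⁻¹.mulVec
        (fun l => hamel F x y (EuclideanSpace.single l 1)) = (P - Q) • (y : Fin n → ℝ) := by
      have e := h.sprayCoeff_eq hx hy
      have e' : sprayCoeff F x y = P • (y : Fin n → ℝ) := funext fun i => hP i
      rw [e'] at e
      rw [sub_smul, e, hQ]
      simp
    have h2 := congrArg (fundamentalTensor F x y).mulVec h1
    rw [Matrix.mulVec_smul, Matrix.mulVec_mulVec, Matrix.mul_nonsing_inv _
      (h.isUnit_det x hx y hy), Matrix.one_mulVec, Matrix.mulVec_smul] at h2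
    have h3 : ∀ l, hamel F x y (EuclideanSpace.single l 1) = 2 * (P - Q) *
        fderiv ℝ (Function.uncurry F) (x, y) (0, EuclideanSpace.single l 1) := by
      intro l
      have := congrFun h2 l
      simp only [Pi.smul_apply, smul_eq_mul, h.fundamentalTensor_mulVec hx hy] at this
      have hh : F x y * (hamel F x y (EuclideanSpace.single l 1)) = F x y * (2 * (P - Q) *
        fderiv ℝ (Function.uncurry F) (x, y) (0, EuclideanSpace.single l 1)) := by linarith
      exact mul_left_cancel₀ hF.ne' hh
    have h4 : ∀ w, hamel F x y w = 2 * (P - Q) * fderiv ℝ (Function.uncurry F) (x, y) (0, w) := by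
      intro w
      rw [hamel_eq_sum]
      have := clm_eq_sum ((fderiv ℝ (Function.uncurry F) (x, y)).comp (.inr ℝ _ _)) w
      simp only [ContinuousLinearMap.comp_apply, ContinuousLinearMap.inr_apply] at this
      rw [this, Finset.mul_sum]
      exact Finset.sum_congr rfl fun i _ => by rw [h3]; ring
    -- At w = y the left side vanishes, while the right side is 2(P − Q)F with F > 0; so P = Q.
    have h5 := h4 y
    rw [h.hamel_self hx hy, h.euler hx hy] at h5
    have h6 : 2 * (P - Q) = 0 := by
      rcases mul_eq_zero.1 h5.symm with h | h
      · exact h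
      · exact absurd h hF.ne'
    intro w
    rw [h4, h6, zero_mul]
  · intro hw
    refine ⟨fderiv ℝ (Function.uncurry F) (x, y) (y, 0) / (2 * F x y), fun i => ?_⟩
    rw [h.sprayCoeff_eq hx hy]
    have : (fun l : Fin n => hamel F x y (EuclideanSpace.single l 1)) = 0 := funext fun l => hw _
    simp [this]

end IsSlitFinsler

end Euler

/-! ### Smoothness of inverse matrices. -/

section MatrixSmooth

variable {X : Type*} [NormedAddCommGroup X] [NormedSpace ℝ X] {m : WithTop ℕ∞}
  {A : X → Matrix (Fin n) (Fin n) ℝ} {p : X}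

theorem contDiffAt_det (hA : ∀ i j, ContDiffAt ℝ m (fun q => A q i j) p) :
    ContDiffAt ℝ m (fun q => (A q).det) p := by
  simp only [Matrix.det_apply]
  refine ContDiffAt.sum fun σ _ => ContDiffAt.const_smul _ (contDiffAt_prod fun i _ => hA _ _)

theorem contDiffAt_matrix_inv (hA : ∀ i j, ContDiffAt ℝ m (fun q => A q i j) p)
    (hdet : IsUnit (A p).det) (i j : Fin n) :
    ContDiffAt ℝ m (fun q => (A q)⁻¹ i j) p := by
  simp only [Matrix.inv_def, Ring.inverse_eq_inv', Matrix.smul_apply, smul_eq_mul,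
    Matrix.adjugate_apply]
  refine ((contDiffAt_det hA).inv hdet.ne_zero).mul (contDiffAt_det fun k l => ?_)
  by_cases hk : k = j
  · subst hk; simp only [Matrix.updateRow_self]; exact contDiffAt_const
  · simp only [Matrix.updateRow_ne hk]; exact hA _ _

end MatrixSmooth

/-! ### Straight curves and proportional acceleration. -/

theorem mem_span_singleton_of_inner {u w : Coord n}
    (h : ∀ q, inner ℝ q u = 0 → inner ℝ q w = 0) : ∃ r : ℝ, w = r • u := by
  have : w ∈ (Submodule.span ℝ {u})ᗮᗮ := by
    rw [Submodule.mem_orthogonal]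
    intro q hq
    refine h q ?_
    exact Submodule.mem_orthogonal' _ _ |>.1 hq u (Submodule.mem_span_singleton_self u)
  rw [Submodule.orthogonal_orthogonal] at this
  obtain ⟨r, hr⟩ := Submodule.mem_span_singleton.1 this
  exact ⟨r, hr.symm⟩

/-- A curve whose acceleration is proportional to its nonzero velocity is a straight line. -/
theorem collinear_of_acceleration {J : Set ℝ} (hJ : IsOpen J) (hJ' : J.OrdConnected)
    {c v : ℝ → Coord n} {k : ℝ → ℝ} (hv0 : ∀ t ∈ J, v t ≠ 0) (hc : ∀ t ∈ J, HasDerivAt c (v t) t)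
    (hv : ∀ t ∈ J, HasDerivAt v (k t • v t) t) : Collinear ℝ (c '' J) := by
  have hpre : IsPreconnected J := hJ'.isPreconnected
  rcases J.eq_empty_or_nonempty with rfl | ⟨t₀, ht₀⟩
  · simp [collinear_empty]
  -- The unit direction v/‖v‖ has zero derivative, hence is constant on the interval.
  have hu : ∀ t ∈ J, HasDerivAt (fun t => ‖v t‖⁻¹ • v t) 0 t := by
    intro t ht
    have hn : 0 < ‖v t‖ := norm_pos_iff.2 (hv0 t ht)
    have h1 : HasDerivAt (fun t => ‖v t‖ ^ 2) (2 * inner ℝ (v t) (k t • v t)) t :=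
      (hv t ht).norm_sq
    have h2 := (h1.sqrt (by positivity)).inv (by simp [hn.ne'])
    have h3 := h2.smul (hv t ht)
    have e : ((fun t => √(‖v t‖ ^ 2))⁻¹ • v) = fun t => ‖v t‖⁻¹ • v t := by
      ext1 t; simp
    rw [e] at h3
    refine h3.congr_deriv ?_
    simp only [Pi.inv_apply, Real.sqrt_sq hn.le, inner_smul_right, real_inner_self_eq_norm_sq,
      smul_smul, ← add_smul]
    rw [smul_eq_zero]
    left
    field_simp
    ring
  have hconst : ∀ t ∈ J, ‖v t‖⁻¹ • v t = ‖v t₀‖⁻¹ • v t₀ := fun t ht =>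
    hJ.is_const_of_deriv_eq_zero hpre
      (fun s hs => (hu s hs).differentiableAt.differentiableWithinAt)
      (fun s hs => (hu s hs).deriv) ht ht₀
  have hvt : ∀ t ∈ J, v t = (‖v t‖ * ‖v t₀‖⁻¹) • v t₀ := by
    intro t ht
    rw [mul_smul, ← hconst t ht, smul_smul, mul_inv_cancel₀ (norm_ne_zero_iff.2 (hv0 t ht)),
      one_smul]
  rw [collinear_iff_of_mem (Set.mem_image_of_mem c ht₀)]
  refine ⟨v t₀, ?_⟩
  rintro _ ⟨t, ht, rfl⟩
  -- Every q orthogonal to the fixed direction has ⟨q, c⟩ constant, so the displacement lies on the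
  -- line spanned by v t₀.
  obtain ⟨r, hr⟩ := mem_span_singleton_of_inner (u := v t₀) (w := c t - c t₀) fun q hq => by
    have hd : ∀ s ∈ J, HasDerivAt (fun s => inner ℝ q (c s)) 0 s := by
      intro s hs
      have := (hasDerivAt_const s q).inner ℝ (hc s hs)
      rw [hvt s hs] at this
      simpa [inner_smul_right, hq] using this
    have := hJ.is_const_of_deriv_eq_zero hpre
      (fun s hs => (hd s hs).differentiableAt.differentiableWithinAt)
      (fun s hs => (hd s hs).deriv) ht ht₀
    rw [inner_sub_right, this, sub_self]
  exact ⟨r, by rw [← hr]; simp⟩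

/-- The acceleration of a straight regular curve is proportional to its velocity. -/
theorem acceleration_of_collinear {J : Set ℝ} (hJ : IsOpen J) {c v : ℝ → Coord n} {t₀ : ℝ}
    (ht₀ : t₀ ∈ J) (hv0 : v t₀ ≠ 0) (hc : ∀ t ∈ J, HasDerivAt c (v t) t) {v' : Coord n}
    (hv : HasDerivAt v v' t₀) (hcol : Collinear ℝ (c '' J)) : ∃ k : ℝ, v' = k • v t₀ := by
  obtain ⟨w, hw⟩ := (collinear_iff_of_mem (Set.mem_image_of_mem c ht₀)).1 hcol
  -- A vector q orthogonal to the line has constant product with c, so it is orthogonal to both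
  -- velocity and acceleration.
  have hi : ∀ q, inner ℝ q w = 0 → (∀ t ∈ J, inner ℝ q (v t) = 0) ∧ inner ℝ q v' = 0 := by
    intro q hq
    have h1 : ∀ t ∈ J, inner ℝ q (c t) = inner ℝ q (c t₀) := by
      intro t ht
      obtain ⟨r, hr⟩ := hw (c t) (Set.mem_image_of_mem c ht)
      rw [hr]
      simp [inner_add_right, inner_smul_right, hq]
    have h2 : ∀ t ∈ J, inner ℝ q (v t) = 0 := by
      intro t ht
      have e1 := (hasDerivAt_const t q).inner ℝ (hc t ht)
      have e2 : HasDerivAt (fun s => inner ℝ q (c s)) 0 t := by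
        refine (hasDerivAt_const t (inner ℝ q (c t₀))).congr_of_eventuallyEq ?_
        filter_upwards [hJ.mem_nhds ht] with s hs using h1 s hs
      simpa using e1.unique e2
    refine ⟨h2, ?_⟩
    have e1 := (hasDerivAt_const t₀ q).inner ℝ hv
    have e2 : HasDerivAt (fun s => inner ℝ q (v s)) 0 t₀ := by
      refine (hasDerivAt_const t₀ (0 : ℝ)).congr_of_eventuallyEq ?_
      filter_upwards [hJ.mem_nhds ht₀] with s hs using h2 s hs
    simpa using e1.unique e2
  obtain ⟨r, hr⟩ := mem_span_singleton_of_inner fun q hq => (hi q hq).1 t₀ ht₀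
  obtain ⟨r', hr'⟩ := mem_span_singleton_of_inner fun q hq => (hi q hq).2
  have hr0 : r ≠ 0 := by rintro rfl; simp at hr; exact hv0 hr
  exact ⟨r' / r, by rw [hr', hr, smul_smul, div_mul_cancel₀ _ hr0]⟩

/-! ### Existence of geodesics and Hamel's criterion. -/

namespace IsSlitFinsler

variable {F : Coord n → Coord n → ℝ} {U : Set (Coord n)}

/-- Regularity of the geodesic vector field, which the existence theorem for ordinary differential
equations requires. -/
theorem contDiffAt_sprayCoeff (h : IsSlitFinsler F U) {x y : Coord n} (hx : x ∈ U) (hy : y ≠ 0)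
    (i : Fin n) :
    ContDiffAt ℝ ∞ (fun p : Coord n × Coord n => sprayCoeff F p.1 p.2 i) (x, y) := by
  have hc := h.contDiffAt hx hy
  have hc1 : ContDiffAt ℝ ∞ (fderiv ℝ (Function.uncurry F)) (x, y) := contDiffAt_fderiv hc
  have hc2 : ContDiffAt ℝ ∞ (fderiv ℝ (fderiv ℝ (Function.uncurry F))) (x, y) :=
    hc1.fderiv_right (by simp)
  have hF : ContDiffAt ℝ ∞ (fun p : Coord n × Coord n => F p.1 p.2) (x, y) := hc
  have hnear := eventually_slit h.isOpen (p := (x, y)) hx hy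
  have hg : ∀ k l, ContDiffAt ℝ ∞ (fun p : Coord n × Coord n => fundamentalTensor F p.1 p.2 k l)
      (x, y) := by
    intro k l
    refine ContDiffAt.congr_of_eventuallyEq ?_
      (Filter.mem_of_superset hnear fun p hp => h.fundamentalTensor_apply hp.1 hp.2 k l)
    exact ((hc1.clm_apply contDiffAt_const).mul (hc1.clm_apply contDiffAt_const)).add
      (hF.mul ((hc2.clm_apply contDiffAt_const).clm_apply contDiffAt_const))
  have hs : ∀ l, ContDiffAt ℝ ∞ (fun p : Coord n × Coord n =>
      (∑ k : Fin n, partialDeriv l (fun w => partialDeriv k (fun z => F z w ^ 2) p.1) p.2 * p.2 k)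
      - partialDeriv l (fun z => F z p.2 ^ 2) p.1) (x, y) := by
    intro l
    refine ContDiffAt.congr_of_eventuallyEq ?_
      (Filter.mem_of_superset hnear fun p hp => h.spray_covector hp.1 hp.2 l)
    have hy0 : ContDiffAt ℝ ∞ (fun p : Coord n × Coord n => (p.2, (0 : Coord n))) (x, y) := by
      fun_prop
    have hh : ContDiffAt ℝ ∞ (fun p : Coord n × Coord n =>
        hamel F p.1 p.2 (EuclideanSpace.single l 1)) (x, y) :=
      ((hc2.clm_apply hy0).clm_apply contDiffAt_const).sub (hc1.clm_apply contDiffAt_const)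
    exact ((contDiffAt_const.mul hF).mul hh).add
      ((contDiffAt_const.mul (hc1.clm_apply hy0)).mul (hc1.clm_apply contDiffAt_const))
  exact contDiffAt_const.mul (ContDiffAt.sum fun l _ =>
    (contDiffAt_matrix_inv hg (h.isUnit_det x hx y hy) i l).mul (hs l))

/-- Through every nonzero tangent vector there is a geodesic. -/
theorem exists_geodesic (h : IsSlitFinsler F U) {x y : Coord n} (hx : x ∈ U) (hy : y ≠ 0) :
    ∃ δ > 0, ∃ c v : ℝ → Coord n, c 0 = x ∧ v 0 = y ∧ ∀ t ∈ Set.Ioo (-δ) δ,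
      c t ∈ U ∧ v t ≠ 0 ∧ HasDerivAt c (v t) t ∧
      HasDerivAt v (WithLp.toLp 2 fun i => -2 * sprayCoeff F (c t) (v t) i) t := by
  -- The geodesic equation as an autonomous first-order system for position and velocity.
  let V : Coord n × Coord n → Coord n × Coord n :=
    fun p => (p.2, WithLp.toLp 2 fun i => -2 * sprayCoeff F p.1 p.2 i)
  have hV : ContDiffAt ℝ 1 V (x, y) := by
    refine contDiffAt_snd.prodMk ?_
    rw [contDiffAt_piLp]
    exact fun i => contDiffAt_const.mul ((h.contDiffAt_sprayCoeff hx hy i).of_le (by norm_cast))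
  obtain ⟨r, hr, ε, hε, H⟩ :=
    hV.exists_forall_mem_closedBall_exists_eq_forall_mem_Ioo_hasDerivAt 0
  obtain ⟨γ, hγ0, hγ⟩ := H (x, y) (Metric.mem_closedBall_self hr.le)
  have hcont : ContinuousAt γ 0 := (hγ 0 (by simp [hε])).continuousAt
  -- By continuity the solution stays in the slit domain for a short time; the interval is shrunk
  -- accordingly.
  have hnear : ∀ᶠ t in 𝓝 (0 : ℝ), γ t ∈ U ×ˢ ({0}ᶜ : Set (Coord n)) :=
    hcont (by rw [hγ0]; exact eventually_slit h.isOpen hx hy)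
  obtain ⟨δ, hδ, hball⟩ := Metric.eventually_nhds_iff.1 hnear
  refine ⟨min δ ε, lt_min hδ hε, fun t => (γ t).1, fun t => (γ t).2, by simp [hγ0], by simp [hγ0],
    fun t ht => ?_⟩
  have ht1 : |t| < min δ ε := abs_lt.2 ht
  have hm := hball (y := t) (by simpa using ht1.trans_le (min_le_left _ _))
  have hd := hγ t (by
    have := abs_lt.1 (ht1.trans_le (min_le_right _ _)); simpa using this)
  exact ⟨hm.1, hm.2, hd.fst, hd.snd⟩

/-- **Hamel's criterion**: the geodesics are straight if and only if Hamel's equation holds. -/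
theorem geodesicsAreStraight_iff (h : IsSlitFinsler F U) :
    GeodesicsAreStraight F U ↔ ∀ x ∈ U, ∀ y ≠ 0, ∀ w, hamel F x y w = 0 := by
  constructor
  · intro hs x hx y hy
    rw [← h.spray_parallel_iff hx hy]
    obtain ⟨δ, hδ, c, v, hc0, hv0, hcv⟩ := h.exists_geodesic hx hy
    have h0 : (0 : ℝ) ∈ Set.Ioo (-δ) δ := by simp [hδ]
    have hcol := hs (Set.Ioo (-δ) δ) c isOpen_Ioo Set.ordConnected_Ioo ⟨v, hcv⟩
    obtain ⟨k, hk⟩ := acceleration_of_collinear isOpen_Ioo h0 (hcv 0 h0).2.1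
      (fun t ht => (hcv t ht).2.2.1) (hcv 0 h0).2.2.2 hcol
    refine ⟨-k / 2, fun i => ?_⟩
    have := congrArg (fun z : Coord n => z i) hk
    simp [hc0, hv0] at this
    linarith
  · rintro hH J c hJ hJ' ⟨v, hv⟩
    have hP : ∀ t, ∃ P : ℝ, t ∈ J → ∀ i, sprayCoeff F (c t) (v t) i = P * v t i := by
      intro t
      by_cases ht : t ∈ J
      · obtain ⟨P, hP⟩ := (h.spray_parallel_iff (hv t ht).1 (hv t ht).2.1).2
          (hH _ (hv t ht).1 _ (hv t ht).2.1)
        exact ⟨P, fun _ => hP⟩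
      · exact ⟨0, fun h => absurd h ht⟩
    choose P hP using hP
    refine collinear_of_acceleration hJ hJ' (v := v) (k := fun t => -2 * P t)
      (fun t ht => (hv t ht).2.1) (fun t ht => (hv t ht).2.2.1) fun t ht => ?_
    convert (hv t ht).2.2.2 using 1
    ext i
    simp [hP t ht, mul_assoc]

end IsSlitFinsler

/-! ### Hamel's expression for f α + g β + k β²/α. -/

theorem hamel_eq_of_hasDerivAt {F : Coord n → Coord n → ℝ} {x y w : Coord n}
    (hF : ContDiffAt ℝ ∞ (Function.uncurry F) (x, y)) {Fw : Coord n → ℝ} {m l : ℝ}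
    (h1 : ∀ᶠ z in 𝓝 x, HasDerivAt (fun t : ℝ => F z (y + t • w)) (Fw z) 0)
    (h2 : HasDerivAt (fun t : ℝ => Fw (x + t • y)) m 0)
    (h3 : HasDerivAt (fun t : ℝ => F (x + t • w) y) l 0) : hamel F x y w = m - l := by
  have e3 : fderiv ℝ (Function.uncurry F) (x, y) (w, 0) = l := by
    have := (differentiableAt_of_contDiffAt hF).hasFDerivAt.hasLineDerivAt (w, 0)
    refine HasDerivAt.unique ?_ h3
    simpa [HasLineDerivAt] using this
  have e1 : ∀ᶠ z in 𝓝 x, fderiv ℝ (Function.uncurry F) (z, y) (0, w) = Fw z := by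
    have hc : Filter.Tendsto (fun z : Coord n => (z, y)) (𝓝 x) (𝓝 (x, y)) :=
      Continuous.tendsto (by fun_prop) x
    filter_upwards [h1, hc.eventually (eventually_contDiffAt hF)] with z hz hd
    have := hd.hasFDerivAt.hasLineDerivAt (0, w)
    refine HasDerivAt.unique ?_ hz
    simpa [HasLineDerivAt] using this
  have e2 : fderiv ℝ (fderiv ℝ (Function.uncurry F)) (x, y) (y, 0) (0, w) = m := by
    have hd := (differentiableAt_fderiv_apply hF (0, w)).hasFDerivAt.hasLineDerivAt (y, 0)
    rw [fderiv_fderiv_apply hF] at hd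
    have hc : Filter.Tendsto (fun t : ℝ => x + t • y) (𝓝 0) (𝓝 x) := by
      have : Continuous fun t : ℝ => x + t • y := by fun_prop
      simpa using this.tendsto 0
    refine HasDerivAt.unique ?_ h2
    have hd' : HasDerivAt (fun t : ℝ => fderiv ℝ (Function.uncurry F) (x + t • y, y) (0, w))
        (fderiv ℝ (fderiv ℝ (Function.uncurry F)) (x, y) (y, 0) (0, w)) 0 := by
      simpa [HasLineDerivAt] using hd
    exact hd'.congr_of_eventuallyEq ((hc.eventually e1).mono fun t ht => ht.symm)
  rw [hamel, e2, e3]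

/-- The Christoffel form of the first kind of a metric tensor, `Γ_{w, uv}`. -/
def koszul (a : Coord n → Coord n →L[ℝ] Coord n →L[ℝ] ℝ) (x u v w : Coord n) : ℝ :=
  (1 / 2) * (fderiv ℝ a x u v w + fderiv ℝ a x v u w - fderiv ℝ a x w u v)

/-- The defect `α² Γ_{w, yy} - a(y, w) Γ_{y, yy}` of the geodesics of `a` from being straight. -/
def projDefect (a : Coord n → Coord n →L[ℝ] Coord n →L[ℝ] ℝ) (x y w : Coord n) : ℝ :=
  a x y y * koszul a x y y w - a x y w * koszul a x y y y

/-- A smooth Riemannian metric on a coordinate domain. -/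
structure IsMetricOn (a : Coord n → Coord n →L[ℝ] Coord n →L[ℝ] ℝ) (U : Set (Coord n)) :
    Prop where
  isOpen : IsOpen U
  smooth : ContDiffOn ℝ ∞ a U
  symm : ∀ x ∈ U, ∀ v w, a x v w = a x w v
  pos : ∀ x ∈ U, ∀ v ≠ 0, 0 < a x v v

/-- The function `f α + g β + k β² / α`. -/
def alphaBeta (a : Coord n → Coord n →L[ℝ] Coord n →L[ℝ] ℝ) (b : Coord n → Coord n →L[ℝ] ℝ)
    (f g : Coord n → ℝ) (k : ℝ) (x y : Coord n) : ℝ :=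
  f x * √(a x y y) + g x * b x y + k * (b x y ^ 2 / √(a x y y))

section AlphaBeta

variable {a : Coord n → Coord n →L[ℝ] Coord n →L[ℝ] ℝ} {b : Coord n → Coord n →L[ℝ] ℝ}
  {f g : Coord n → ℝ} {U : Set (Coord n)} {x y : Coord n}

theorem contDiffAt_alphaBeta (ha : IsMetricOn a U) (hb : ContDiffOn ℝ ∞ b U)
    (hf : ContDiffOn ℝ ∞ f U) (hg : ContDiffOn ℝ ∞ g U) (k : ℝ) (hx : x ∈ U) (hy : y ≠ 0) :
    ContDiffAt ℝ ∞ (Function.uncurry (alphaBeta a b f g k)) (x, y) := by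
  have hU := ha.isOpen.mem_nhds hx
  have lift : ∀ {G : Type} [NormedAddCommGroup G] [NormedSpace ℝ G] {φ : Coord n → G},
      ContDiffOn ℝ ∞ φ U → ContDiffAt ℝ ∞ (fun p : Coord n × Coord n => φ p.1) (x, y) := by
    intro G _ _ φ hφ
    exact (hφ.contDiffAt hU).comp (x, y) contDiffAt_fst
  have h2 : ContDiffAt ℝ ∞ (fun p : Coord n × Coord n => p.2) (x, y) := contDiffAt_snd
  have hA : ContDiffAt ℝ ∞ (fun p : Coord n × Coord n => √(a p.1 p.2 p.2)) (x, y) :=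
    (((lift ha.smooth).clm_apply h2).clm_apply h2).sqrt (ha.pos x hx y hy).ne'
  have hA0 : √(a x y y) ≠ 0 := (Real.sqrt_pos.2 (ha.pos x hx y hy)).ne'
  have hB : ContDiffAt ℝ ∞ (fun p : Coord n × Coord n => b p.1 p.2) (x, y) :=
    (lift hb).clm_apply h2
  exact (((lift hf).mul hA).add ((lift hg).mul hB)).add
    (contDiffAt_const.mul ((hB.pow 2).div hA hA0))

theorem hasDerivAt_line {G : Type*} [NormedAddCommGroup G] [NormedSpace ℝ G] {φ : Coord n → G}
    (hU : IsOpen U) (hφ : ContDiffOn ℝ ∞ φ U) (hx : x ∈ U) (v : Coord n) :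
    HasDerivAt (fun t : ℝ => φ (x + t • v)) (fderiv ℝ φ x v) 0 :=
  ((hφ.contDiffAt (hU.mem_nhds hx)).differentiableAt (by simp)).hasFDerivAt.hasLineDerivAt v

/-- The left-hand side of Hamel's equation for `f α + g β + k β² / α`. -/
theorem hamel_alphaBeta (ha : IsMetricOn a U) (hb : ContDiffOn ℝ ∞ b U)
    (hf : ContDiffOn ℝ ∞ f U) (hg : ContDiffOn ℝ ∞ g U) (k : ℝ) (hx : x ∈ U) (hy : y ≠ 0)
    (w : Coord n) :
    hamel (alphaBeta a b f g k) x y w =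
      f x * projDefect a x y w / √(a x y y) ^ 3 + fderiv ℝ f x y * a x y w / √(a x y y)
        - fderiv ℝ f x w * √(a x y y)
      + g x * (fderiv ℝ b x y w - fderiv ℝ b x w y) + fderiv ℝ g x y * b x w
        - fderiv ℝ g x w * b x y
      + k / √(a x y y) ^ 5 * (2 * fderiv ℝ b x y y * a x y y * (a x y y * b x w - b x y * a x y w)
        + 2 * b x y * a x y y ^ 2 * (fderiv ℝ b x y w - fderiv ℝ b x w y)
        - 2 * a x y y * b x y * b x w * koszul a x y y y
        + 3 * b x y ^ 2 * a x y w * koszul a x y y y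
        - a x y y * b x y ^ 2 * koszul a x y y w) := by
  have hA := ha.pos x hx y hy
  have hs : 0 < √(a x y y) := Real.sqrt_pos.2 hA
  have hU := ha.isOpen
  have da := fun v => hasDerivAt_line hU ha.smooth hx v
  have db := fun v => hasDerivAt_line hU hb hx v
  have df := fun v => hasDerivAt_line hU hf hx v
  have dg := fun v => hasDerivAt_line hU hg hx v
  have da' : ∀ u v z, HasDerivAt (fun t : ℝ => a (x + t • u) v z) (fderiv ℝ a x u v z) 0 := by
    intro u v z
    have := ((da u).clm_apply (hasDerivAt_const (0 : ℝ) v)).clm_apply (hasDerivAt_const (0 : ℝ) z)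
    simpa using this
  have db' : ∀ u v, HasDerivAt (fun t : ℝ => b (x + t • u) v) (fderiv ℝ b x u v) 0 := by
    intro u v
    have := (db u).clm_apply (hasDerivAt_const (0 : ℝ) v)
    simpa using this
  have x0 : ∀ u : Coord n, x + (0 : ℝ) • u = x := by simp
  have y0 : y + (0 : ℝ) • w = y := by simp
  -- `Fw` is the fibre derivative in direction w at fixed y. It is then differentiated in the base
  -- direction y, so only derivatives along lines have to be computed.
  rw [hamel_eq_of_hasDerivAt (contDiffAt_alphaBeta ha hb hf hg k hx hy)
    (Fw := fun z => f z * (a z y w / √(a z y y)) + g z * b z w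
      + k * (2 * b z y * b z w / √(a z y y) - b z y ^ 2 * a z y w / √(a z y y) ^ 3))
    (m := _) (l := _) ?_ ?_ ?_]
  rotate_left 3
  · filter_upwards [hU.mem_nhds hx] with z hz
    have hz1 := ha.pos z hz y hy
    have hs1 : 0 < √(a z y y) := Real.sqrt_pos.2 hz1
    have e1 : HasDerivAt (fun t : ℝ => y + t • w) w 0 := by
      simpa using ((hasDerivAt_id (0 : ℝ)).smul_const w).const_add y
    have e2 : HasDerivAt (fun t : ℝ => a z (y + t • w) (y + t • w)) (2 * a z y w) 0 := by
      have := ((a z).hasFDerivAt.comp_hasDerivAt (0 : ℝ) e1).clm_apply e1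
      simp only [Function.comp_apply, y0] at this
      refine this.congr_deriv ?_
      rw [ha.symm z hz w y]; ring
    have e3 : HasDerivAt (fun t : ℝ => b z (y + t • w)) (b z w) 0 :=
      (b z).hasFDerivAt.comp_hasDerivAt (0 : ℝ) e1
    have e4 := e2.sqrt (by simpa using hz1.ne')
    have e5 := ((e4.const_mul (f z)).add (e3.const_mul (g z))).add
      (((e3.pow 2).div e4 (by simpa using hs1.ne')).const_mul k)
    refine e5.congr_deriv ?_
    simp only [y0]
    field_simp
    simp
    ring
  · have s1 := (da' y y y).sqrt (by simpa using hA.ne')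
    have s2 := (df y).mul ((da' y y w).div s1 (by simpa using hs.ne'))
    have s3 := (dg y).mul (db' y w)
    have s4 := (((db' y y).const_mul 2).mul (db' y w)).div s1 (by simpa using hs.ne')
    have s5 := (((db' y y).pow 2).mul (da' y y w)).div (s1.pow 3)
      (by simpa using hs.ne')
    exact (s2.add s3).add ((s4.sub s5).const_mul k)
  · have s1 := (da' w y y).sqrt (by simpa using hA.ne')
    exact (((df w).mul s1).add ((dg w).mul (db' w y))).add
      ((((db' w y).pow 2).div s1 (by simpa using hs.ne')).const_mul k)
  · simp only [x0, Pi.mul_apply, Pi.pow_apply, Pi.div_apply, koszul, projDefect]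
    -- Treating s = √a(y,y) as the variable and replacing a(y,y) by s² makes the claim a rational
    -- identity.
    have hsq : a x y y = √(a x y y) ^ 2 := (Real.sq_sqrt hA.le).symm
    generalize √(a x y y) = s at *
    rw [hsq]
    field_simp
    ring

end AlphaBeta

/-! ### Raising indices, norms and the symmetrized covariant derivative. -/

/-- The vector field dual to the 1-form `b` with respect to the metric tensor `a`. -/
def sharp (a : Coord n → Coord n →L[ℝ] Coord n →L[ℝ] ℝ) (b : Coord n → Coord n →L[ℝ] ℝ)
    (x : Coord n) : Coord n :=
  (a x).inverse (b x)

/-- The squared norm of the 1-form `b` with respect to the metric tensor `a`. -/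
def normSq (a : Coord n → Coord n →L[ℝ] Coord n →L[ℝ] ℝ) (b : Coord n → Coord n →L[ℝ] ℝ)
    (x : Coord n) : ℝ :=
  b x (sharp a b x)

/-- The symmetrized covariant derivative of the 1-form `b` with respect to `a`. -/
def covSym (a : Coord n → Coord n →L[ℝ] Coord n →L[ℝ] ℝ) (b : Coord n → Coord n →L[ℝ] ℝ)
    (x v w : Coord n) : ℝ :=
  (1 / 2) * (fderiv ℝ b x v w + fderiv ℝ b x w v) - koszul a x v w (sharp a b x)

section Sharp

variable {a : Coord n → Coord n →L[ℝ] Coord n →L[ℝ] ℝ} {b : Coord n → Coord n →L[ℝ] ℝ}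
  {U : Set (Coord n)} {x : Coord n}

namespace IsMetricOn

/-- Positivity gives injectivity, and equality of dimensions does the rest. Hence
`ContinuousLinearMap.inverse` is a true inverse in `sharp` and is smooth there. -/
theorem exists_equiv (ha : IsMetricOn a U) (hx : x ∈ U) :
    ∃ e : Coord n ≃L[ℝ] (Coord n →L[ℝ] ℝ), (e : Coord n →L[ℝ] Coord n →L[ℝ] ℝ) = a x := by
  have hinj : Function.Injective (a x : Coord n →ₗ[ℝ] Coord n →L[ℝ] ℝ) := by
    rw [← LinearMap.ker_eq_bot, LinearMap.ker_eq_bot']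
    intro v hv
    by_contra h
    have := ha.pos x hx v h
    have hv' : a x v = 0 := hv
    simp [hv'] at this
  have hdim : Module.finrank ℝ (Coord n) = Module.finrank ℝ (Coord n →L[ℝ] ℝ) := by
    rw [← (LinearMap.toContinuousLinearMap (𝕜 := ℝ) (E := Coord n) (F' := ℝ)).finrank_eq]
    exact (Subspace.dual_finrank_eq (K := ℝ) (V := Coord n)).symm
  refine ⟨(LinearEquiv.ofInjectiveOfFinrankEq _ hinj hdim).toContinuousLinearEquiv, ?_⟩
  ext v w
  rfl

theorem apply_sharp (ha : IsMetricOn a U) (hx : x ∈ U) : a x (sharp a b x) = b x := by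
  obtain ⟨e, he⟩ := ha.exists_equiv hx
  rw [sharp, ← he, ContinuousLinearMap.inverse_equiv]
  simp

theorem eq_sharp (ha : IsMetricOn a U) (hx : x ∈ U) {s : Coord n} (hs : a x s = b x) :
    s = sharp a b x := by
  obtain ⟨e, he⟩ := ha.exists_equiv hx
  rw [sharp, ← hs, ← he, ContinuousLinearMap.inverse_equiv]
  simp

theorem contDiffOn_sharp (ha : IsMetricOn a U) (hb : ContDiffOn ℝ ∞ b U) :
    ContDiffOn ℝ ∞ (sharp a b) U := by
  intro x hx
  obtain ⟨e, he⟩ := ha.exists_equiv hx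
  have h1 : ContDiffAt ℝ ∞ ContinuousLinearMap.inverse (a x) := he ▸ contDiffAt_map_inverse e
  exact (h1.comp_contDiffWithinAt x (ha.smooth x hx)).clm_apply (hb x hx)

theorem contDiffOn_normSq (ha : IsMetricOn a U) (hb : ContDiffOn ℝ ∞ b U) :
    ContDiffOn ℝ ∞ (normSq a b) U :=
  hb.clm_apply (ha.contDiffOn_sharp hb)

theorem apply_sharp_left (ha : IsMetricOn a U) (hx : x ∈ U) (v : Coord n) :
    a x (sharp a b x) v = b x v := by rw [ha.apply_sharp hx]

theorem apply_sharp_right (ha : IsMetricOn a U) (hx : x ∈ U) (v : Coord n) :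
    a x v (sharp a b x) = b x v := by rw [ha.symm x hx, ha.apply_sharp hx]

theorem nonneg (ha : IsMetricOn a U) (hx : x ∈ U) (v : Coord n) : 0 ≤ a x v v := by
  rcases eq_or_ne v 0 with rfl | hv
  · simp
  · exact (ha.pos x hx v hv).le

theorem normSq_nonneg (ha : IsMetricOn a U) (hx : x ∈ U) : 0 ≤ normSq a b x := by
  rw [normSq, ← ha.apply_sharp_left hx]
  exact ha.nonneg hx _

theorem sharp_eq_zero (ha : IsMetricOn a U) (hx : x ∈ U) (h : b x = 0) : sharp a b x = 0 :=
  (ha.eq_sharp hx (s := 0) (by simp [h])).symm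

theorem normSq_pos (ha : IsMetricOn a U) (hx : x ∈ U) (h : b x ≠ 0) : 0 < normSq a b x := by
  rw [normSq, ← ha.apply_sharp_left hx]
  refine ha.pos x hx _ fun h0 => h ?_
  rw [← ha.apply_sharp (b := b) hx, h0, map_zero]

/-- Expand a(v,v) ≥ 0 for v = b² y − b(y) b^♯ and cancel b² > 0; when b = 0 both sides vanish. -/
theorem cauchy_schwarz (ha : IsMetricOn a U) (hx : x ∈ U) (y : Coord n) :
    b x y ^ 2 ≤ normSq a b x * a x y y := by
  by_cases h : b x = 0
  · simp [h, normSq]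
  have hB := ha.normSq_pos hx h
  have h1 := ha.nonneg hx (normSq a b x • y - b x y • sharp a b x)
  simp only [map_sub, map_smul, sub_apply, smul_apply,
    smul_eq_mul, ha.apply_sharp_left hx, ha.apply_sharp_right hx] at h1
  have h2 : b x (sharp a b x) = normSq a b x := rfl
  rw [h2] at h1
  have h3 : 0 ≤ normSq a b x * (normSq a b x * a x y y - b x y ^ 2) := by linarith
  nlinarith [nonneg_of_mul_nonneg_right h3 hB]

theorem differentiableAt (ha : IsMetricOn a U) (hx : x ∈ U) : DifferentiableAt ℝ a x :=
  (ha.smooth.contDiffAt (ha.isOpen.mem_nhds hx)).differentiableAt (by simp)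

theorem fderiv_apply_apply (ha : IsMetricOn a U) (hx : x ∈ U) (u v w : Coord n) :
    fderiv ℝ (fun z => a z v w) x u = fderiv ℝ a x u v w := by
  have h1 := (ha.differentiableAt hx).hasFDerivAt.clm_apply (hasFDerivAt_const v x)
  have h2 := h1.clm_apply (hasFDerivAt_const w x)
  rw [h2.fderiv]
  simp

theorem fderiv_symm (ha : IsMetricOn a U) (hx : x ∈ U) (u v w : Coord n) :
    fderiv ℝ a x u v w = fderiv ℝ a x u w v := by
  rw [← ha.fderiv_apply_apply hx, ← ha.fderiv_apply_apply hx]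
  refine congrArg (fun L : Coord n →L[ℝ] ℝ => L u) (Filter.EventuallyEq.fderiv_eq ?_)
  filter_upwards [ha.isOpen.mem_nhds hx] with z hz using ha.symm z hz v w

/-- The derivative of `b²` is `2 r_{ij} bⁱ` for closed `b`. -/
theorem fderiv_normSq (ha : IsMetricOn a U) (hb : ContDiffOn ℝ ∞ b U) (hx : x ∈ U)
    (hcl : ∀ v w, fderiv ℝ b x v w = fderiv ℝ b x w v) (w : Coord n) :
    fderiv ℝ (normSq a b) x w = 2 * covSym a b x (sharp a b x) w := by
  have hU := ha.isOpen.mem_nhds hx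
  have hdb : HasFDerivAt b (fderiv ℝ b x) x :=
    ((hb.contDiffAt hU).differentiableAt (by simp)).hasFDerivAt
  have hds : HasFDerivAt (sharp a b) (fderiv ℝ (sharp a b) x) x :=
    (((ha.contDiffOn_sharp hb).contDiffAt hU).differentiableAt (by simp)).hasFDerivAt
  have hda := (ha.differentiableAt hx).hasFDerivAt
  -- Differentiate b² both as b(b^♯) and as a(b^♯, b^♯), then eliminate the unknown derivative of
  -- b^♯.
  have h1 : fderiv ℝ (normSq a b) x w = b x (fderiv ℝ (sharp a b) x w)
      + fderiv ℝ b x w (sharp a b x) := by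
    have := (hdb.clm_apply hds).fderiv
    rw [show normSq a b = fun z => b z (sharp a b z) from rfl, this]
    simp
  have h2 : fderiv ℝ (normSq a b) x w = fderiv ℝ a x w (sharp a b x) (sharp a b x)
      + 2 * b x (fderiv ℝ (sharp a b) x w) := by
    have e : normSq a b =ᶠ[𝓝 x] fun z => a z (sharp a b z) (sharp a b z) := by
      filter_upwards [hU] with z hz
      rw [ha.apply_sharp_left hz]; rfl
    rw [e.fderiv_eq, ((hda.clm_apply hds).clm_apply hds).fderiv]
    simp [ha.apply_sharp_left hx, ha.apply_sharp_right hx]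
    ring
  rw [covSym, koszul, hcl w, ha.fderiv_symm hx (sharp a b x) w]
  rw [hcl w] at h1
  linarith

theorem covSym_comm (ha : IsMetricOn a U) (hx : x ∈ U) (v w : Coord n) :
    covSym a b x v w = covSym a b x w v := by
  simp only [covSym, koszul, ha.fderiv_symm hx (sharp a b x) v w]
  ring

end IsMetricOn

theorem covSym_add_left (u v w : Coord n) :
    covSym a b x (u + v) w = covSym a b x u w + covSym a b x v w := by
  simp only [covSym, koszul, map_add, add_apply]
  ring

theorem covSym_add_right (u v w : Coord n) :
    covSym a b x u (v + w) = covSym a b x u v + covSym a b x u w := by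
  simp only [covSym, koszul, map_add, add_apply]
  ring

/-- Polarization: a symmetrized covariant derivative is determined by its quadratic form. -/
theorem covSym_eq_of_quadratic (ha : IsMetricOn a U) (hx : x ∈ U) {τ p q : ℝ}
    (h : ∀ v, covSym a b x v v = τ * (p * a x v v - q * b x v ^ 2)) (v w : Coord n) :
    covSym a b x v w = τ * (p * a x v w - q * b x v * b x w) := by
  have h1 := h (v + w)
  rw [covSym_add_left, covSym_add_right, covSym_add_right, h, h, ha.covSym_comm hx w v] at h1
  simp only [map_add, add_apply, ha.symm x hx w v] at h1
  linarith

end Sharp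

/-! ### Divisibility of polynomials by quadratics. -/

theorem coeff_eq_zero {c₀ c₁ c₂ c₃ c₄ c₅ : ℝ}
    (h : ∀ z : ℝ, c₀ + c₁ * z + c₂ * z ^ 2 + c₃ * z ^ 3 + c₄ * z ^ 4 + c₅ * z ^ 5 = 0) :
    c₀ = 0 ∧ c₁ = 0 ∧ c₂ = 0 ∧ c₃ = 0 ∧ c₄ = 0 ∧ c₅ = 0 := by
  -- Six values determine a polynomial of degree at most five.
  have h0 := h 0
  have h1 := h 1
  have h2 := h (-1)
  have h3 := h 2
  have h4 := h (-2)
  have h5 := h 3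
  norm_num at h0 h1 h2 h3 h4 h5
  refine ⟨h0, ?_, ?_, ?_, ?_, ?_⟩ <;> linarith

/-- If `(u z² + v) (t₀ + t₁ z + t₂ z² + t₃ z³) = (p z² + q) (r₀ + r₁ z + r₂ z²)` with coprime
quadratic factors, then the last factor is a multiple of `u z² + v`. -/
theorem quadratic_factor {u v p q t₀ t₁ t₂ t₃ r₀ r₁ r₂ : ℝ} (hu : u ≠ 0) (hd : v * p ≠ u * q)
    (h : ∀ z : ℝ, (u * z ^ 2 + v) * (t₀ + t₁ * z + t₂ * z ^ 2 + t₃ * z ^ 3)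
      = (p * z ^ 2 + q) * (r₀ + r₁ * z + r₂ * z ^ 2)) :
    r₁ = 0 ∧ r₀ * u = r₂ * v := by
  obtain ⟨e0, e1, e2, e3, e4, e5⟩ := coeff_eq_zero
    (c₀ := v * t₀ - q * r₀) (c₁ := v * t₁ - q * r₁) (c₂ := u * t₀ + v * t₂ - p * r₀ - q * r₂)
    (c₃ := u * t₁ + v * t₃ - p * r₁) (c₄ := u * t₂ - p * r₂) (c₅ := u * t₃)
    fun z => by linear_combination h z
  -- The coefficient of z⁵ is u t₃. With t₃ gone, eliminating the other tᵢ leaves relations on the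
  -- rᵢ multiplied by powers or products of u, v and by v p − u q, which coprimality makes nonzero.
  have ht3 : t₃ = 0 := (mul_eq_zero.1 e5).resolve_left hu
  subst ht3
  have hd' : v * p - u * q ≠ 0 := sub_ne_zero.2 hd
  constructor
  · have : r₁ * (v * p - u * q) = 0 := by linear_combination u * e1 - v * e3
    exact (mul_eq_zero.1 this).resolve_right hd'
  · have : (r₀ * u - r₂ * v) * (v * p - u * q) = 0 := by
      linear_combination u * u * e0 - u * v * e2 + v * v * e4
    linarith [(mul_eq_zero.1 this).resolve_right hd']

/-! ### Pointwise algebra of Hamel's equation. -/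

section Algebra

variable {a : Coord n → Coord n →L[ℝ] Coord n →L[ℝ] ℝ} {b : Coord n → Coord n →L[ℝ] ℝ}
  {U : Set (Coord n)} {x : Coord n}

theorem koszul_line_left (z : ℝ) (s q w : Coord n) :
    koszul a x (z • s + q) (z • s + q) w =
      koszul a x q q w + (koszul a x s q w + koszul a x q s w) * z + koszul a x s s w * z ^ 2 := by
  simp only [koszul, map_add, map_smul, add_apply, smul_apply, smul_eq_mul]
  ring

theorem koszul_line_right (z : ℝ) (u v s q : Coord n) :
    koszul a x u v (z • s + q) = z * koszul a x u v s + koszul a x u v q := by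
  simp only [koszul, map_add, map_smul, add_apply, smul_apply, smul_eq_mul]
  ring

theorem covSym_line (z : ℝ) (s q : Coord n) :
    covSym a b x (z • s + q) (z • s + q) =
      covSym a b x q q + (covSym a b x s q + covSym a b x q s) * z + covSym a b x s s * z ^ 2 := by
  simp only [covSym, koszul_line_left, map_add, map_smul, add_apply, smul_apply, smul_eq_mul]
  ring

/-- The quadratic form `(1 + 2 b²) α² - 3 β²`. -/
def quadD (a : Coord n → Coord n →L[ℝ] Coord n →L[ℝ] ℝ) (b : Coord n → Coord n →L[ℝ] ℝ)
    (x y : Coord n) : ℝ :=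
  (1 + 2 * normSq a b x) * a x y y - 3 * b x y ^ 2

/-- By Cauchy–Schwarz the form is at least (1 − b²)α². -/
theorem quadD_pos (ha : IsMetricOn a U) (hx : x ∈ U) (hB : normSq a b x < 1) {y : Coord n}
    (hy : y ≠ 0) : 0 < quadD a b x y := by
  have h1 := ha.cauchy_schwarz (b := b) hx y
  have h2 := ha.pos x hx y hy
  have h3 : 0 < (1 - normSq a b x) * a x y y := mul_pos (by linarith) h2
  rw [quadD]
  linarith

/-- The two equations on `(a, b)` which are equivalent to the local projective flatness of
`α + 2 β + β² / α`. -/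
theorem hamel_split (ha : IsMetricOn a U) (hb : ContDiffOn ℝ ∞ b U) (hx : x ∈ U)
    (hB : normSq a b x < 1)
    (hH : ∀ y ≠ 0, ∀ w, hamel (alphaBeta a b (fun _ => 1) (fun _ => 2) 1) x y w = 0) :
    (∀ v w, fderiv ℝ b x v w = fderiv ℝ b x w v) ∧
    ∀ y w, quadD a b x y * projDefect a x y w
      + 2 * a x y y * covSym a b x y y * (a x y y * b x w - b x y * a x y w) = 0 := by
  have hH' : ∀ y : Coord n, y ≠ 0 → ∀ w, _ = (0 : ℝ) := fun y hy w =>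
    (hamel_alphaBeta ha hb contDiffOn_const contDiffOn_const 1 hx hy w).symm.trans (hH y hy w)
  simp only [fderiv_fun_const, Pi.zero_apply, zero_apply, zero_mul, sub_zero, add_zero,
    one_mul] at hH'
  -- Under v ↦ −v only the contribution of 2β is odd, so the difference of the two equations
  -- isolates the exterior derivative of b.
  have hcl : ∀ v w, fderiv ℝ b x v w = fderiv ℝ b x w v := by
    intro v w
    rcases eq_or_ne v 0 with rfl | hv
    · simp
    have h1 := hH' v hv w
    have h2 := hH' (-v) (neg_ne_zero.2 hv) w
    simp only [projDefect, koszul, map_neg, neg_apply, neg_neg] at h1 h2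
    linear_combination (h1 - h2) / 4
  refine ⟨hcl, fun y w => ?_⟩
  rcases eq_or_ne y 0 with rfl | hy
  · simp [quadD]
  have hA := ha.pos x hx y hy
  have hCS := ha.cauchy_schwarz (b := b) hx y
  have hs : 0 < √(a x y y) := Real.sqrt_pos.2 hA
  have hE : ∀ w, a x y y * projDefect a x y w
      + (2 * fderiv ℝ b x y y * a x y y * (a x y y * b x w - b x y * a x y w)
        - 2 * a x y y * b x y * b x w * koszul a x y y y
        + 3 * b x y ^ 2 * a x y w * koszul a x y y y
        - a x y y * b x y ^ 2 * koszul a x y y w) = 0 := by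
    intro w
    have h1 := hH' y hy w
    rw [hcl y w, sub_self, mul_zero, mul_zero, add_zero, add_zero] at h1
    have h2 : √(a x y y) ^ 2 = a x y y := Real.sq_sqrt hA.le
    generalize √(a x y y) = s at h1 h2 hs
    rw [← h2] at h1 ⊢
    field_simp at h1
    linear_combination h1
  -- The equation for w = b^♯ brings in the Christoffel term that completes the derivative of b to a
  -- covariant one. The combination carries a factor α² − β², nonzero because b² < 1.
  have hEw := hE w
  have hEs := hE (sharp a b x)
  rw [ha.apply_sharp_right hx, show b x (sharp a b x) = normSq a b x from rfl] at hEs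
  have hne : a x y y - b x y ^ 2 ≠ 0 := by
    have : normSq a b x * a x y y < 1 * a x y y := by gcongr
    linarith
  refine (mul_eq_zero.1 (?_ : (a x y y - b x y ^ 2) * _ = 0)).resolve_left hne
  simp only [projDefect, quadD, covSym] at hEw hEs ⊢
  rw [ha.apply_sharp_right hx]  at hEs
  linear_combination ((1 + 2 * normSq a b x) * a x y y - 3 * b x y ^ 2) * hEw
    - 2 * (a x y y * b x w - b x y * a x y w) * hEs

/-- Where `b ≠ 0`, the symmetrized covariant derivative is proportional to
`(1 + 2 b²) α² - 3 β²`. -/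
theorem covSym_proportional_of_ne_zero (ha : IsMetricOn a U) (hx : x ∈ U)
    (hB : normSq a b x < 1) (hb0 : b x ≠ 0)
    (h : ∀ y w, quadD a b x y * projDefect a x y w
      + 2 * a x y y * covSym a b x y y * (a x y y * b x w - b x y * a x y w) = 0) (y : Coord n) :
    covSym a b x y y * quadD a b x (sharp a b x)
      = covSym a b x (sharp a b x) (sharp a b x) * quadD a b x y := by
  set s := sharp a b x with hs
  set B := normSq a b x with hBdef
  have hBp : 0 < B := ha.normSq_pos hx hb0
  have hss : a x s s = B := ha.apply_sharp_left hx s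
  have hbs : b x s = B := rfl
  set z₀ := b x y / B with hz₀
  -- q is the component of y orthogonal to b^♯. Along z b^♯ + q both α² and D are even quadratics in
  -- z.
  set q := y - z₀ • s with hq
  have hyq : y = z₀ • s + q := by simp [hq]
  have hbq : b x q = 0 := by
    rw [hq, map_sub, map_smul, hbs, smul_eq_mul, hz₀]; field_simp; ring
  have hsq : a x s q = 0 := by rw [ha.apply_sharp_left hx, hbq]
  have hqs : a x q s = 0 := by rw [ha.symm x hx, hsq]
  have hA : ∀ z : ℝ, a x (z • s + q) (z • s + q) = B * z ^ 2 + a x q q := by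
    intro z
    simp only [map_add, map_smul, add_apply, smul_apply, smul_eq_mul, hss, hsq, hqs]
    ring
  have hb' : ∀ z : ℝ, b x (z • s + q) = B * z := by
    intro z
    simp only [map_add, map_smul, smul_eq_mul, hbs, hbq]
    ring
  have hD : ∀ z : ℝ, quadD a b x (z • s + q)
      = B * (1 - B) * z ^ 2 + (1 + 2 * B) * a x q q := by
    intro z
    rw [quadD, hA, hb', ← hBdef]
    ring
  have hDs : quadD a b x s = B * (1 - B) := by
    rw [quadD, hss, hbs, ← hBdef]; ring
  rcases eq_or_ne q 0 with hq0 | hq0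
  · rw [hq0, add_zero] at hyq
    rw [hyq]
    simp only [covSym, koszul, quadD, map_smul, smul_apply, smul_eq_mul]
    ring
  have hQ := ha.pos x hx q hq0
  -- The hypothesis with w = b^♯ along this line; there b² α² − β² is the constant b² a(q,q).
  have key : ∀ z : ℝ, (B * (1 - B) * z ^ 2 + (1 + 2 * B) * a x q q) *
      (a x q q * koszul a x q q s
        + (a x q q * (koszul a x s q s + koszul a x q s s) - B * koszul a x q q q) * z
        + (a x q q * koszul a x s s s - B * (koszul a x s q q + koszul a x q s q)) * z ^ 2
        + (- B * koszul a x s s q) * z ^ 3)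
      = (B * z ^ 2 + a x q q) * (-2 * B * a x q q * covSym a b x q q
        + (-2 * B * a x q q * (covSym a b x s q + covSym a b x q s)) * z
        + (-2 * B * a x q q * covSym a b x s s) * z ^ 2) := by
    intro z
    have h1 := h (z • s + q) s
    rw [projDefect, koszul_line_right, ha.apply_sharp_right hx, hD, hA, hb', koszul_line_left,
      koszul_line_left, covSym_line, hbs] at h1
    linear_combination h1
  -- For D and α² as polynomials in z, the coprimality determinant is 3 b⁴ a(q,q) > 0.
  obtain ⟨k1, k2⟩ := quadratic_factor (by have : 0 < 1 - B := by linarith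
                                          positivity)
    (by
      have : 0 < 3 * B ^ 2 * a x q q := by positivity
      intro h; nlinarith) key
  have hc : -2 * B * a x q q ≠ 0 := by
    have : 0 < B * a x q q := by positivity
    intro h; linarith
  have k1' := (mul_eq_zero.1 k1).resolve_left hc
  have k2' : covSym a b x q q * (B * (1 - B)) = covSym a b x s s * ((1 + 2 * B) * a x q q) :=
    mul_left_cancel₀ hc (by linear_combination k2)
  rw [hyq, covSym_line, hD, hDs, k1']
  linear_combination k2'

end Algebra

/-! ### The deformation on a coordinate domain. -/

section Local

variable {a : Coord n → Coord n →L[ℝ] Coord n →L[ℝ] ℝ} {b : Coord n → Coord n →L[ℝ] ℝ}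
  {U : Set (Coord n)} {x : Coord n}

theorem contDiffOn_infty_fderiv {G : Type*} [NormedAddCommGroup G] [NormedSpace ℝ G]
    {φ : Coord n → G} (hU : IsOpen U) (hφ : ContDiffOn ℝ ∞ φ U) :
    ContinuousOn (fderiv ℝ φ) U :=
  hφ.continuousOn_fderiv_of_isOpen hU (by simp)

theorem continuousOn_covSym (ha : IsMetricOn a U) (hb : ContDiffOn ℝ ∞ b U) (v : Coord n) :
    ContinuousOn (fun z => covSym a b z v v) U := by
  have h1 := contDiffOn_infty_fderiv ha.isOpen ha.smooth
  have h2 := contDiffOn_infty_fderiv ha.isOpen hb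
  have h3 := (ha.contDiffOn_sharp hb).continuousOn
  have c : ∀ v : Coord n, ContinuousOn (fun _ : Coord n => v) U := fun v => continuousOn_const
  have k1 : ContinuousOn (fun z => fderiv ℝ a z v v (sharp a b z)) U :=
    ((h1.clm_apply (c v)).clm_apply (c v)).clm_apply h3
  have k2 : ContinuousOn (fun z => fderiv ℝ a z (sharp a b z) v v) U :=
    ((h1.clm_apply h3).clm_apply (c v)).clm_apply (c v)
  have k3 : ContinuousOn (fun z => fderiv ℝ b z v v) U := (h2.clm_apply (c v)).clm_apply (c v)
  exact (continuousOn_const.mul (k3.add k3)).sub (continuousOn_const.mul ((k1.add k1).sub k2))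

theorem continuousOn_quadD (ha : IsMetricOn a U) (hb : ContDiffOn ℝ ∞ b U) (v : Coord n) :
    ContinuousOn (fun z => quadD a b z v) U := by
  have h1 := (ha.contDiffOn_normSq hb).continuousOn
  have h2 : ContinuousOn (fun z => a z v v) U :=
    (ha.smooth.continuousOn.clm_apply continuousOn_const).clm_apply continuousOn_const
  have h3 : ContinuousOn (fun z => b z v) U := hb.continuousOn.clm_apply continuousOn_const
  exact ((continuousOn_const.add (continuousOn_const.mul h1)).mul h2).sub
    (continuousOn_const.mul (h3.pow 2))

/-- On all of `U` the symmetrized covariant derivative is proportional to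
`(1 + 2 b²) α² - 3 β²`; at the boundary points of `{b = 0}` this holds by continuity. -/
theorem exists_covSym_eq (ha : IsMetricOn a U) (hb : ContDiffOn ℝ ∞ b U)
    (hB : ∀ x ∈ U, normSq a b x < 1)
    (h : ∀ x ∈ U, ∀ y w, quadD a b x y * projDefect a x y w
      + 2 * a x y y * covSym a b x y y * (a x y y * b x w - b x y * a x y w) = 0) (hx : x ∈ U) :
    ∃ τ : ℝ, ∀ v w, covSym a b x v w =
      τ * ((1 + 2 * normSq a b x) * a x v w - 3 * b x v * b x w) := by
  -- Proportionality is written without division, as an equality of continuous functions of the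
  -- point, so it passes to limits.
  have hprop : ∀ v w, covSym a b x v v * quadD a b x w = covSym a b x w w * quadD a b x v := by
    intro v w
    by_contra hne
    have hcont : ContinuousAt
        (fun z => covSym a b z v v * quadD a b z w - covSym a b z w w * quadD a b z v) x :=
      (((continuousOn_covSym ha hb v).mul (continuousOn_quadD ha hb w)).sub
        ((continuousOn_covSym ha hb w).mul (continuousOn_quadD ha hb v))).continuousAt
        (ha.isOpen.mem_nhds hx)
    -- Failure at x persists nearby, which is impossible where b ≠ 0. So b vanishes near x, and then
    -- r = 0 at x, contradicting the failure.
    have hev : ∀ᶠ z in 𝓝 x, b z = 0 := by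
      filter_upwards [hcont.eventually_ne (sub_ne_zero.2 hne), ha.isOpen.mem_nhds hx] with z hz hzU
      by_contra hb0
      apply hz
      have e1 := covSym_proportional_of_ne_zero ha hzU (hB z hzU) hb0 (h z hzU) v
      have e2 := covSym_proportional_of_ne_zero ha hzU (hB z hzU) hb0 (h z hzU) w
      have hs0 : sharp a b z ≠ 0 := by
        intro h0
        apply hb0
        rw [← ha.apply_sharp (b := b) hzU, h0, map_zero]
      have hp := (quadD_pos ha hzU (hB z hzU) hs0).ne'
      refine (mul_eq_zero.1 (?_ : quadD a b z (sharp a b z) * _ = 0)).resolve_left hp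
      linear_combination quadD a b z w * e1 - quadD a b z v * e2
    have hd : fderiv ℝ b x = 0 := by
      rw [Filter.EventuallyEq.fderiv_eq (f := fun _ => 0) hev]; simp
    have hs : sharp a b x = 0 := ha.sharp_eq_zero hx hev.self_of_nhds
    apply hne
    simp [covSym, koszul, hd, hs]
  suffices ∃ τ : ℝ, ∀ v, covSym a b x v v =
      τ * ((1 + 2 * normSq a b x) * a x v v - 3 * b x v ^ 2) by
    obtain ⟨τ, hτ⟩ := this
    exact ⟨τ, fun v w => covSym_eq_of_quadratic ha hx hτ v w⟩
  by_cases hv : ∃ v : Coord n, v ≠ 0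
  · obtain ⟨v, hv⟩ := hv
    have hp := quadD_pos ha hx (hB x hx) hv
    refine ⟨covSym a b x v v / quadD a b x v, fun w => ?_⟩
    have := hprop v w
    rw [div_mul_eq_mul_div, eq_div_iff hp.ne', ← this]
    rfl
  -- Dimension zero: any τ works.
  · push Not at hv
    exact ⟨0, fun v => by rw [hv v]; simp [covSym, koszul]⟩

/-- The metric tensor `(1 - b²)² a`. -/
def deformedMetric (a : Coord n → Coord n →L[ℝ] Coord n →L[ℝ] ℝ)
    (b : Coord n → Coord n →L[ℝ] ℝ) (x : Coord n) : Coord n →L[ℝ] Coord n →L[ℝ] ℝ :=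
  (1 - normSq a b x) ^ 2 • a x

/-- The 1-form `√(1 - b²) b`. -/
def deformedForm (a : Coord n → Coord n →L[ℝ] Coord n →L[ℝ] ℝ)
    (b : Coord n → Coord n →L[ℝ] ℝ) (x : Coord n) : Coord n →L[ℝ] ℝ :=
  √(1 - normSq a b x) • b x

theorem isMetricOn_deformedMetric (ha : IsMetricOn a U) (hb : ContDiffOn ℝ ∞ b U)
    (hB : ∀ x ∈ U, normSq a b x < 1) : IsMetricOn (deformedMetric a b) U where
  isOpen := ha.isOpen
  smooth := by
    simp only [contDiffOn_clm_apply, deformedMetric, smul_apply]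
    exact fun v w => ((contDiffOn_const.sub (ha.contDiffOn_normSq hb)).pow 2).smul
      ((ha.smooth.clm_apply contDiffOn_const).clm_apply contDiffOn_const)
  symm x hx v w := by simp [deformedMetric, ha.symm x hx v w]
  pos x hx v hv := by
    have h1 := ha.pos x hx v hv
    have h2 : 0 < 1 - normSq a b x := by linarith [hB x hx]
    simp only [deformedMetric, smul_apply, smul_eq_mul]
    positivity

theorem contDiffOn_sqrt_one_sub_normSq (ha : IsMetricOn a U) (hb : ContDiffOn ℝ ∞ b U)
    (hB : ∀ x ∈ U, normSq a b x < 1) : ContDiffOn ℝ ∞ (fun z => √(1 - normSq a b z)) U :=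
  (contDiffOn_const.sub (ha.contDiffOn_normSq hb)).sqrt fun x hx => by
    have := hB x hx
    linarith

theorem hasFDerivAt_of_contDiffOn {G : Type*} [NormedAddCommGroup G] [NormedSpace ℝ G]
    {φ : Coord n → G} (hU : IsOpen U) (hφ : ContDiffOn ℝ ∞ φ U) (hx : x ∈ U) :
    HasFDerivAt φ (fderiv ℝ φ x) x :=
  ((hφ.contDiffAt (hU.mem_nhds hx)).differentiableAt (by simp)).hasFDerivAt

theorem sharp_deformed (ha : IsMetricOn a U) (hb : ContDiffOn ℝ ∞ b U)
    (hB : ∀ x ∈ U, normSq a b x < 1) (hx : x ∈ U) :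
    sharp (deformedMetric a b) (deformedForm a b) x
      = (√(1 - normSq a b x) / (1 - normSq a b x) ^ 2) • sharp a b x := by
  have h2 : 0 < 1 - normSq a b x := by linarith [hB x hx]
  refine ((isMetricOn_deformedMetric ha hb hB).eq_sharp hx ?_).symm
  rw [map_smul, deformedMetric, deformedForm, smul_apply, ha.apply_sharp hx, smul_smul,
    div_mul_cancel₀ _ (by positivity)]

/-- Raising an index multiplies by (1 − b²)^(−2), while the two copies of the form contribute 1 −
b². This gives 1 + b̄² = 1/(1 − b²). -/
theorem normSq_deformed (ha : IsMetricOn a U) (hb : ContDiffOn ℝ ∞ b U)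
    (hB : ∀ x ∈ U, normSq a b x < 1) (hx : x ∈ U) :
    normSq (deformedMetric a b) (deformedForm a b) x
      = normSq a b x / (1 - normSq a b x) := by
  have h2 : 0 < 1 - normSq a b x := by linarith [hB x hx]
  have h3 : √(1 - normSq a b x) ^ 2 = 1 - normSq a b x := Real.sq_sqrt h2.le
  rw [normSq, sharp_deformed ha hb hB hx, deformedForm, smul_apply, map_smul, smul_eq_mul,
    smul_eq_mul, show b x (sharp a b x) = normSq a b x from rfl]
  field_simp
  rw [h3]

/-- If `α + 2 β + β² / α` satisfies Hamel's equation, then so does `(1 - b²) α`, and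
`√(1 - b²) β` is closed and conformal with respect to it. -/
theorem deformation_of_hamel (ha : IsMetricOn a U) (hb : ContDiffOn ℝ ∞ b U)
    (hB : ∀ x ∈ U, normSq a b x < 1)
    (hH : ∀ x ∈ U, ∀ y ≠ 0, ∀ w,
      hamel (alphaBeta a b (fun _ => 1) (fun _ => 2) 1) x y w = 0) (hx : x ∈ U) :
    (∀ y ≠ 0, ∀ w,
      hamel (alphaBeta a b (fun z => 1 - normSq a b z) (fun _ => 0) 0) x y w = 0) ∧
    (∀ v w, fderiv ℝ (deformedForm a b) x v w = fderiv ℝ (deformedForm a b) x w v) ∧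
    ∃ c : ℝ, ∀ v w, covSym (deformedMetric a b) (deformedForm a b) x v w
      = c * deformedMetric a b x v w := by
  have hsplit := fun z hz => hamel_split ha hb hz (hB z hz) (hH z hz)
  obtain ⟨τ, hτ⟩ := exists_covSym_eq ha hb hB (fun z hz => (hsplit z hz).2) hx
  obtain ⟨hcl, hstar⟩ := hsplit x hx
  have hBx := hB x hx
  have hdB := ha.fderiv_normSq hb hx hcl
  have hbs : b x (sharp a b x) = normSq a b x := rfl
  have hU := ha.isOpen
  set f : Coord n → ℝ := fun z => 1 - normSq a b z with hf
  have hfs : ContDiffOn ℝ ∞ f U := contDiffOn_const.sub (ha.contDiffOn_normSq hb)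
  have hfx : 0 < f x := by simp only [hf]; linarith
  -- From d(b²) = 2r(b^♯, ·): the factor 1 + 2b² loses 3b² to the b⊗b term, leaving 1 − b².
  have hdf : ∀ w, fderiv ℝ f x w = -2 * τ * f x * b x w := by
    intro w
    have e : fderiv ℝ f x = - fderiv ℝ (normSq a b) x := by
      simp only [hf]; rw [fderiv_const_sub]
    rw [e, neg_apply, hdB, hτ, ha.apply_sharp_left hx, hbs]
    simp only [hf]; ring
  have hh : 0 < √(f x) := Real.sqrt_pos.2 hfx
  have hhh : √(f x) ^ 2 = f x := Real.sq_sqrt hfx.le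
  have hhs : ContDiffOn ℝ ∞ (fun z => √(f z)) U := contDiffOn_sqrt_one_sub_normSq ha hb hB
  have hdh : ∀ w, fderiv ℝ (fun z => √(f z)) x w = -τ * √(f x) * b x w := by
    intro w
    rw [((hasFDerivAt_of_contDiffOn hU hfs hx).sqrt hfx.ne').fderiv]
    simp only [smul_apply, smul_eq_mul, hdf]
    field_simp
    rw [hhh]
    ring
  have hdb' : ∀ v w, fderiv ℝ (deformedForm a b) x v w
      = √(f x) * fderiv ℝ b x v w - τ * √(f x) * b x v * b x w := by
    intro v w
    have := ((hasFDerivAt_of_contDiffOn hU hhs hx).smul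
      (hasFDerivAt_of_contDiffOn hU hb hx)).fderiv
    have e : deformedForm a b = (fun z => √(f z)) • b := rfl
    rw [e, this]
    simp [hdh]
    ring
  have hda' : ∀ u v w, fderiv ℝ (deformedMetric a b) x u v w
      = f x ^ 2 * fderiv ℝ a x u v w - 4 * τ * f x ^ 2 * b x u * a x v w := by
    intro u v w
    have hav : ContDiffOn ℝ ∞ (fun z => a z v w) U :=
      (ha.smooth.clm_apply contDiffOn_const).clm_apply contDiffOn_const
    have := (((hasFDerivAt_of_contDiffOn hU hfs hx).pow 2).mul
      (hasFDerivAt_of_contDiffOn hU hav hx)).fderiv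
    have e : (fun z => deformedMetric a b z v w) =
        (fun z => f z ^ 2) * fun z => a z v w := rfl
    rw [← (isMetricOn_deformedMetric ha hb hB).fderiv_apply_apply hx, e, this]
    simp [hdf, ha.fderiv_apply_apply hx]
    ring
  -- The b⊗b terms cancel in the deformed covariant derivative, leaving τ√f a; dividing by f² refers
  -- it to the metric f² a.
  refine ⟨fun y hy w => ?_, fun v w => ?_, τ * √(f x) / f x ^ 2, fun v w => ?_⟩
  · rw [hamel_alphaBeta ha hb hfs contDiffOn_const 0 hx hy w]
    have hA := ha.pos x hx y hy
    have hs : 0 < √(a x y y) := Real.sqrt_pos.2 hA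
    have hD := quadD_pos ha hx hBx hy
    -- Insert r(y,y) = τD in the split equation and cancel D > 0.
    have hT : projDefect a x y w = -2 * a x y y * τ * (a x y y * b x w - b x y * a x y w) := by
      have h1 := hstar y w
      have h2 : covSym a b x y y = τ * quadD a b x y := by rw [hτ, quadD]; ring
      rw [h2] at h1
      refine mul_left_cancel₀ hD.ne' ?_
      linear_combination h1
    rw [hT, hdf, hdf]
    have h2 : √(a x y y) ^ 2 = a x y y := Real.sq_sqrt hA.le
    simp only [fderiv_fun_const, Pi.zero_apply, zero_apply, zero_mul, sub_zero, add_zero, zero_div]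
    generalize √(a x y y) = s at h2 hs
    rw [← h2]
    field_simp
    ring
  · rw [hdb', hdb', hcl v w]; ring
  · have hs' := sharp_deformed ha hb hB hx
    change _ = (√(f x) / f x ^ 2) • _ at hs'
    have hτ' := hτ v w
    rw [covSym, koszul] at hτ' ⊢
    rw [hs']
    have e : normSq a b x = 1 - f x := by simp only [hf]; ring
    simp only [map_smul, smul_apply, smul_eq_mul, hda', hdb', ha.apply_sharp_right hx, hbs,
      deformedMetric, e] at hτ' ⊢
    clear_value f
    field_simp
    linear_combination 2 * f x ^ 2 * hτ'

/-- If `α` satisfies Hamel's equation and `β` is closed and conformal, then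
`(1 + b²) α + 2 √(1 + b²) β + β² / α` satisfies Hamel's equation. -/
theorem hamel_of_deformation (ha : IsMetricOn a U) (hb : ContDiffOn ℝ ∞ b U) (hx : x ∈ U)
    (hH : ∀ y ≠ 0, ∀ w, hamel (alphaBeta a b (fun _ => 1) (fun _ => 0) 0) x y w = 0)
    (hcl : ∀ v w, fderiv ℝ b x v w = fderiv ℝ b x w v) {c : ℝ}
    (hc : ∀ v w, covSym a b x v w = c * a x v w) {y : Coord n} (hy : y ≠ 0) (w : Coord n) :
    hamel (alphaBeta a b (fun z => 1 + normSq a b z) (fun z => 2 * √(1 + normSq a b z)) 1) x y w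
      = 0 := by
  have hA := ha.pos x hx y hy
  have hs : 0 < √(a x y y) := Real.sqrt_pos.2 hA
  have h2 : √(a x y y) ^ 2 = a x y y := Real.sq_sqrt hA.le
  have hU := ha.isOpen
  have hdB := ha.fderiv_normSq hb hx hcl
  set f : Coord n → ℝ := fun z => 1 + normSq a b z with hf
  have hfs : ContDiffOn ℝ ∞ f U := contDiffOn_const.add (ha.contDiffOn_normSq hb)
  have hfp : ∀ z ∈ U, 0 < f z := fun z hz => by
    have := ha.normSq_nonneg (b := b) hz
    simp only [hf]; linarith
  have hfx := hfp x hx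
  have hdf : ∀ w, fderiv ℝ f x w = 2 * c * b x w := by
    intro w
    simp only [hf]
    rw [fderiv_const_add, hdB, hc, ha.apply_sharp_left hx]; ring
  have hgs : ContDiffOn ℝ ∞ (fun z => 2 * √(f z)) U :=
    contDiffOn_const.mul (hfs.sqrt fun z hz => (hfp z hz).ne')
  have hdg : ∀ w, fderiv ℝ (fun z => 2 * √(f z)) x w = 2 * c / √(f x) * b x w := by
    intro w
    have hh : 0 < √(f x) := Real.sqrt_pos.2 hfx
    rw [(((hasFDerivAt_of_contDiffOn hU hfs hx).sqrt hfx.ne').const_mul 2).fderiv]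
    simp only [smul_apply, smul_eq_mul, hdf]
    field_simp
  -- For α alone Hamel's expression is T/α³.
  have hT : ∀ w, projDefect a x y w = 0 := by
    intro w
    have h1 := hH y hy w
    rw [hamel_alphaBeta ha hb contDiffOn_const contDiffOn_const 0 hx hy w] at h1
    simp only [fderiv_fun_const, Pi.zero_apply, zero_apply, zero_mul, sub_zero, add_zero,
      zero_div, one_mul] at h1
    rcases div_eq_zero_iff.1 h1 with h | h
    · exact h
    · exact absurd h (by positivity)
  have hTw := hT w
  -- Contracting T = 0 with b^♯ gives α² Γ(y,y,b^♯) = β(y) Γ(y,y,y), which removes the Christoffel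
  -- term entering through the derivative of b.
  have hTs := hT (sharp a b x)
  have hcy := hc y y
  rw [projDefect, ha.apply_sharp_right hx] at hTs
  rw [hamel_alphaBeta ha hb hfs hgs 1 hx hy w, hT w, hcl y w, hdf, hdf, hdg, hdg]
  rw [covSym] at hcy
  rw [projDefect] at hTw
  have hdb : fderiv ℝ b x y y = c * a x y y + koszul a x y y (sharp a b x) := by linarith
  rw [hdb]
  generalize √(a x y y) = s at h2 hs
  rw [← h2] at hTw hTs ⊢
  field_simp
  linear_combination √(f x) * ((-b x y ^ 2) * hTw + (2 * (s ^ 2 * b x w - b x y * a x y w)) * hTs)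

end Local

/-! ### Index notation against invariant notation. -/

section Components

variable {a : Coord n → Coord n →L[ℝ] Coord n →L[ℝ] ℝ} {b : Coord n → Coord n →L[ℝ] ℝ}
  {U : Set (Coord n)} {x : Coord n}

/-- The matrix of a metric tensor. -/
def metricMatrix (a : Coord n → Coord n →L[ℝ] Coord n →L[ℝ] ℝ) (x : Coord n) :
    Matrix (Fin n) (Fin n) ℝ :=
  Matrix.of fun i j => a x (EuclideanSpace.single i 1) (EuclideanSpace.single j 1)

theorem metric_eq_sum (L : Coord n →L[ℝ] Coord n →L[ℝ] ℝ) (v w : Coord n) :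
    L v w = ∑ i, v i * ∑ j, w j *
      L (EuclideanSpace.single i 1) (EuclideanSpace.single j 1) := by
  conv_lhs => rw [clm_eq_sum (L v) w]
  have : ∀ z, L v z = ∑ i, v i * L (EuclideanSpace.single i 1) z := fun z =>
    clm_eq_sum (L.flip z) v
  simp only [this, Finset.mul_sum]
  rw [Finset.sum_comm]
  exact Finset.sum_congr rfl fun _ _ => Finset.sum_congr rfl fun _ _ => by ring

theorem posDef_metricMatrix (ha : IsMetricOn a U) (hx : x ∈ U) : (metricMatrix a x).PosDef := by
  refine Matrix.PosDef.of_dotProduct_mulVec_pos ?_ fun v hv => ?_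
  · ext i j
    simp [metricMatrix, ha.symm x hx (EuclideanSpace.single i 1)]
  · have h := ha.pos x hx (WithLp.toLp 2 v) (by simpa using hv)
    rw [metric_eq_sum] at h
    simpa [dotProduct, Matrix.mulVec, metricMatrix, mul_comm] using h

theorem sum_inv_eq_sharp (ha : IsMetricOn a U) (hx : x ∈ U) (l : Fin n) :
    ∑ k, b x (EuclideanSpace.single k 1) * (metricMatrix a x)⁻¹ k l = sharp a b x l := by
  have h1 : (fun k => b x (EuclideanSpace.single k 1)) =
      Matrix.vecMul (sharp a b x) (metricMatrix a x) := by
    ext k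
    rw [← ha.apply_sharp_left hx]
    exact clm_eq_sum ((a x).flip (EuclideanSpace.single k 1)) (sharp a b x)
  have h2 : Matrix.vecMul (fun k => b x (EuclideanSpace.single k 1)) (metricMatrix a x)⁻¹ =
      sharp a b x := by
    rw [h1, Matrix.vecMul_vecMul, Matrix.mul_nonsing_inv _
      (posDef_metricMatrix ha hx).det_pos.ne'.isUnit, Matrix.vecMul_one]
  exact congrFun h2 l

theorem koszul_sum (u v s : Coord n) :
    koszul a x u v s = ∑ l, s l * koszul a x u v (EuclideanSpace.single l 1) := by
  have := clm_eq_sum ((1 / 2 : ℝ) • (fderiv ℝ a x u v + fderiv ℝ a x v u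
    - ((fderiv ℝ a x).flip u).flip v)) s
  simpa [koszul] using this

/-- In b_k Γᵏ_ij the inverse matrix moves onto b and produces the components of b^♯. -/
theorem sum_mul_christoffel (ha : IsMetricOn a U) (hx : x ∈ U) (i j : Fin n) :
    ∑ k, b x (EuclideanSpace.single k 1) * christoffel (metricMatrix a) x k i j =
      koszul a x (EuclideanSpace.single i 1) (EuclideanSpace.single j 1) (sharp a b x) := by
  have hd : ∀ i j k, partialDeriv i (fun z => metricMatrix a z j k) x =
      fderiv ℝ a x (EuclideanSpace.single i 1) (EuclideanSpace.single j 1)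
        (EuclideanSpace.single k 1) := fun i j k => ha.fderiv_apply_apply hx _ _ _
  rw [koszul_sum]
  simp only [← sum_inv_eq_sharp (b := b) ha hx, christoffel, hd, Finset.sum_mul, Finset.mul_sum]
  rw [Finset.sum_comm]
  refine Finset.sum_congr rfl fun l _ => Finset.sum_congr rfl fun k _ => ?_
  rw [koszul]
  ring

theorem partialDeriv_form (hU : IsOpen U) (hb : ContDiffOn ℝ ∞ b U) (hx : x ∈ U) (i j : Fin n) :
    partialDeriv j (fun z => b z (EuclideanSpace.single i 1)) x =
      fderiv ℝ b x (EuclideanSpace.single j 1) (EuclideanSpace.single i 1) := by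
  have := ((hasFDerivAt_of_contDiffOn hU hb hx).clm_apply
    (hasFDerivAt_const (EuclideanSpace.single i (1 : ℝ)) x)).fderiv
  rw [partialDeriv, this]
  simp

theorem covDeriv_symm_eq (ha : IsMetricOn a U) (hb : ContDiffOn ℝ ∞ b U) (hx : x ∈ U)
    (i j : Fin n) :
    (1 / 2 : ℝ) * (covDeriv (metricMatrix a) (fun z k => b z (EuclideanSpace.single k 1)) x i j
      + covDeriv (metricMatrix a) (fun z k => b z (EuclideanSpace.single k 1)) x j i) =
      covSym a b x (EuclideanSpace.single i 1) (EuclideanSpace.single j 1) := by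
  simp only [covDeriv, sum_mul_christoffel ha hx, partialDeriv_form ha.isOpen hb hx]
  rw [covSym, koszul, koszul, ha.fderiv_symm hx _ (EuclideanSpace.single j 1)
    (EuclideanSpace.single i 1)]
  ring

theorem forall_closed_iff (hU : IsOpen U) (hb : ContDiffOn ℝ ∞ b U) (hx : x ∈ U) :
    (∀ i j : Fin n, partialDeriv j (fun z => b z (EuclideanSpace.single i 1)) x
      = partialDeriv i (fun z => b z (EuclideanSpace.single j 1)) x) ↔
    ∀ v w, fderiv ℝ b x v w = fderiv ℝ b x w v := by
  simp only [partialDeriv_form hU hb hx]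
  refine ⟨fun h v w => ?_, fun h i j => h _ _⟩
  rw [metric_eq_sum, metric_eq_sum (fderiv ℝ b x) w v]
  simp only [Finset.mul_sum]
  rw [Finset.sum_comm]
  refine Finset.sum_congr rfl fun i _ => Finset.sum_congr rfl fun j _ => ?_
  rw [h i j]; ring

/-- The symmetrized covariant derivative as a bilinear form. -/
def covSymForm (a : Coord n → Coord n →L[ℝ] Coord n →L[ℝ] ℝ) (b : Coord n → Coord n →L[ℝ] ℝ)
    (x : Coord n) : Coord n →L[ℝ] Coord n →L[ℝ] ℝ :=
  (1 / 2 : ℝ) • (fderiv ℝ b x + (fderiv ℝ b x).flip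
    - ((fderiv ℝ a x).flip (sharp a b x) + ((fderiv ℝ a x).flip (sharp a b x)).flip
      - fderiv ℝ a x (sharp a b x)))

/-- Presents the covariant derivative as a continuous bilinear form, so that `metric_eq_sum` reduces
equality to coordinate vectors. -/
theorem covSym_eq_covSymForm (ha : IsMetricOn a U) (hx : x ∈ U) (v w : Coord n) :
    covSym a b x v w = covSymForm a b x v w := by
  simp only [covSym, koszul, covSymForm, smul_apply, sub_apply, add_apply,
    ContinuousLinearMap.flip_apply, smul_eq_mul, ha.fderiv_symm hx _ _ (sharp a b x)]
  ring

theorem forall_conformal_iff (ha : IsMetricOn a U) (hb : ContDiffOn ℝ ∞ b U) (hx : x ∈ U)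
    (c : ℝ) :
    (∀ i j : Fin n, (1 / 2 : ℝ) *
        (covDeriv (metricMatrix a) (fun z k => b z (EuclideanSpace.single k 1)) x i j
          + covDeriv (metricMatrix a) (fun z k => b z (EuclideanSpace.single k 1)) x j i)
        = c * metricMatrix a x i j) ↔
      ∀ v w, covSym a b x v w = c * a x v w := by
  simp only [covDeriv_symm_eq ha hb hx]
  refine ⟨fun h v w => ?_, fun h i j => h _ _⟩
  rw [covSym_eq_covSymForm ha hx, metric_eq_sum, metric_eq_sum (a x)]
  simp only [← covSym_eq_covSymForm ha hx, h, Finset.mul_sum]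
  refine Finset.sum_congr rfl fun i _ => Finset.sum_congr rfl fun j _ => ?_
  simp only [metricMatrix, Matrix.of_apply]
  ring

end Components

/-! ### Naturality under smooth maps. -/

section Pullback

variable {a a' : Coord n → Coord n →L[ℝ] Coord n →L[ℝ] ℝ} {b b' : Coord n → Coord n →L[ℝ] ℝ}
  {U V : Set (Coord n)} {φ : Coord n → Coord n} {x : Coord n}

theorem hasFDerivAt_comp_normed {G : Type*} [NormedAddCommGroup G] [NormedSpace ℝ G]
    {A : Coord n → G} {A' : Coord n →L[ℝ] G} {φ' : Coord n →L[ℝ] Coord n}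
    (hA : HasFDerivAt A A' (φ x)) (hφ : HasFDerivAt φ φ' x) :
    HasFDerivAt (fun z => A (φ z)) (A'.comp φ') x :=
  hA.comp x hφ

/-- The derivative of the pullback of a 1-form. -/
theorem fderiv_pullback_form (hU : IsOpen U) (hb : ContDiffOn ℝ ∞ b U) (hV : IsOpen V)
    (hφ : ContDiffOn ℝ ∞ φ V) (hφU : Set.MapsTo φ V U)
    (hbb : ∀ z ∈ V, ∀ v, b' z v = b (φ z) (fderiv ℝ φ z v)) (hdb' : DifferentiableAt ℝ b' x)
    (hx : x ∈ V) (v w : Coord n) :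
    fderiv ℝ b' x v w = fderiv ℝ b (φ x) (fderiv ℝ φ x v) (fderiv ℝ φ x w)
      + b (φ x) (fderiv ℝ (fderiv ℝ φ) x v w) := by
  have h1 : HasFDerivAt (fun z => b' z w) ((fderiv ℝ b' x).flip w) x := by
    have := hdb'.hasFDerivAt.clm_apply (hasFDerivAt_const w x)
    simpa using this
  have hφx := hasFDerivAt_of_contDiffOn hV hφ hx
  have hdφ : HasFDerivAt (fderiv ℝ φ) (fderiv ℝ (fderiv ℝ φ) x) x :=
    (((hφ.contDiffAt (hV.mem_nhds hx)).fderiv_right (m := ∞) (by simp)).differentiableAt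
      (by simp)).hasFDerivAt
  have hJ : HasFDerivAt (fun z => fderiv ℝ φ z w) ((fderiv ℝ (fderiv ℝ φ) x).flip w) x := by
    have := hdφ.clm_apply (hasFDerivAt_const w x)
    simpa using this
  have h2 := ((hasFDerivAt_of_contDiffOn hU hb (hφU hx)).comp x hφx).clm_apply hJ
  have h3 := h2.congr_of_eventuallyEq (f₁ := fun z => b' z w) (by
    filter_upwards [hV.mem_nhds hx] with z hz using hbb z hz w)
  have := congrArg (fun L : Coord n →L[ℝ] ℝ => L v) (h1.unique h3)
  simp at this
  rw [this]
  ring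

/-- The derivative of the pullback of a metric tensor. -/
theorem fderiv_pullback_metric (ha : IsMetricOn a U) (ha' : IsMetricOn a' V)
    (hφ : ContDiffOn ℝ ∞ φ V) (hφU : Set.MapsTo φ V U)
    (haa : ∀ z ∈ V, ∀ v w, a' z v w = a (φ z) (fderiv ℝ φ z v) (fderiv ℝ φ z w))
    (hx : x ∈ V) (u v w : Coord n) :
    fderiv ℝ a' x u v w =
      fderiv ℝ a (φ x) (fderiv ℝ φ x u) (fderiv ℝ φ x v) (fderiv ℝ φ x w)
      + a (φ x) (fderiv ℝ (fderiv ℝ φ) x u v) (fderiv ℝ φ x w)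
      + a (φ x) (fderiv ℝ φ x v) (fderiv ℝ (fderiv ℝ φ) x u w) := by
  have hV := ha'.isOpen
  have hφx := hasFDerivAt_of_contDiffOn hV hφ hx
  have hdφ : HasFDerivAt (fderiv ℝ φ) (fderiv ℝ (fderiv ℝ φ) x) x :=
    (((hφ.contDiffAt (hV.mem_nhds hx)).fderiv_right (m := ∞) (by simp)).differentiableAt
      (by simp)).hasFDerivAt
  have hJ : ∀ w, HasFDerivAt (fun z => fderiv ℝ φ z w) ((fderiv ℝ (fderiv ℝ φ) x).flip w) x := by
    intro w
    have := hdφ.clm_apply (hasFDerivAt_const w x)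
    simpa using this
  have hA :=
    hasFDerivAt_comp_normed (A := a) (A' := fderiv ℝ a (φ x)) (ha.differentiableAt (hφU hx)).hasFDerivAt hφx
  have hAv := hA.clm_apply (hJ v)
  have h2 := hAv.clm_apply (hJ w)
  have h3 : (fun z => a' z v w) =ᶠ[𝓝 x] fun z => a (φ z) (fderiv ℝ φ z v) (fderiv ℝ φ z w) := by
    filter_upwards [hV.mem_nhds hx] with z hz using haa z hz v w
  rw [← ha'.fderiv_apply_apply hx, h3.fderiv_eq, h2.fderiv]
  simp only [add_apply, ContinuousLinearMap.comp_apply, ContinuousLinearMap.flip_apply]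
  ring

/-- The symmetrized covariant derivative is a tensor. -/
theorem covSym_pullback (ha : IsMetricOn a U) (ha' : IsMetricOn a' V)
    (hb : ContDiffOn ℝ ∞ b U) (hb' : ContDiffOn ℝ ∞ b' V)
    (hφ : ContDiffOn ℝ ∞ φ V) (hφU : Set.MapsTo φ V U)
    (haa : ∀ z ∈ V, ∀ v w, a' z v w = a (φ z) (fderiv ℝ φ z v) (fderiv ℝ φ z w))
    (hbb : ∀ z ∈ V, ∀ v, b' z v = b (φ z) (fderiv ℝ φ z v)) (hx : x ∈ V) (v w : Coord n) :
    covSym a' b' x v w = covSym a b (φ x) (fderiv ℝ φ x v) (fderiv ℝ φ x w) := by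
  have hV := ha'.isOpen
  have hsymm : ∀ v w, fderiv ℝ (fderiv ℝ φ) x v w = fderiv ℝ (fderiv ℝ φ) x w v :=
    ((hφ.contDiffAt (hV.mem_nhds hx)).isSymmSndFDerivAt (by simp; norm_cast)).eq
  -- The pulled-back metric is positive definite, so the derivative is injective, hence onto by
  -- dimension.
  have hsurj : Function.Surjective (fderiv ℝ φ x) := by
    have hinj : Function.Injective (fderiv ℝ φ x : Coord n →ₗ[ℝ] Coord n) := by
      rw [← LinearMap.ker_eq_bot, LinearMap.ker_eq_bot']
      intro z hz
      by_contra h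
      have h1 := ha'.pos x hx z h
      have hz' : fderiv ℝ φ x z = 0 := hz
      rw [haa x hx, hz'] at h1
      simp at h1
    exact LinearMap.surjective_of_injective hinj
  have hs : fderiv ℝ φ x (sharp a' b' x) = sharp a b (φ x) := by
    refine ha.eq_sharp (hφU hx) ?_
    ext z
    obtain ⟨z, rfl⟩ := hsurj z
    rw [← haa x hx, ha'.apply_sharp_left hx, hbb x hx]
  have hfb := fderiv_pullback_form ha.isOpen hb hV hφ hφU hbb
    (hasFDerivAt_of_contDiffOn hV hb' hx).differentiableAt hx
  have hfa := fderiv_pullback_metric ha ha' hφ hφU haa hx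
  -- The second derivatives of φ coming from the form and from the Christoffel terms cancel, because
  -- D²φ is symmetric and a(·, b^♯) = b.
  simp only [covSym, koszul, hfb, hfa, hs, ha.apply_sharp_right (hφU hx),
    hsymm (sharp a' b' x), hsymm w v]
  rw [ha.symm _ (hφU hx) (fderiv ℝ φ x w) (fderiv ℝ (fderiv ℝ φ) x v (sharp a' b' x))]
  ring

end Pullback

/-! ### Instances of slit Finsler functions. -/

section SqrtMetric

variable {a : Coord n → Coord n →L[ℝ] Coord n →L[ℝ] ℝ} {b : Coord n → Coord n →L[ℝ] ℝ}
  {U : Set (Coord n)} {x y : Coord n} {F G : Coord n → Coord n → ℝ}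

theorem hamel_congr (hU : IsOpen U) (h : ∀ x ∈ U, ∀ y ≠ 0, F x y = G x y) (hx : x ∈ U)
    (hy : y ≠ 0) (w : Coord n) : hamel F x y w = hamel G x y w := by
  have e : Function.uncurry F =ᶠ[𝓝 (x, y)] Function.uncurry G := by
    filter_upwards [eventually_slit hU (p := (x, y)) hx hy] with p hp using h p.1 hp.1 p.2 hp.2
  rw [hamel, hamel, e.fderiv.fderiv_eq, e.fderiv_eq]

theorem isSlitFinsler_of_eq_alphaBeta (ha : IsMetricOn a U) (hb : ContDiffOn ℝ ∞ b U)
    {f g : Coord n → ℝ} (hf : ContDiffOn ℝ ∞ f U) (hg : ContDiffOn ℝ ∞ g U) {k : ℝ}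
    (h : ∀ x ∈ U, ∀ y ≠ 0, F x y = alphaBeta a b f g k x y)
    (h0 : ∀ x ∈ U, F x 0 = 0) (hpos : ∀ x ∈ U, ∀ y ≠ 0, 0 < F x y)
    (hdet : ∀ x ∈ U, ∀ y ≠ 0, (fundamentalTensor F x y).PosDef) : IsSlitFinsler F U where
  isOpen := ha.isOpen
  smooth := by
    refine ContDiffOn.congr (f := Function.uncurry (alphaBeta a b f g k)) ?_
      fun p hp => h p.1 hp.1 p.2 hp.2
    exact fun p hp => (contDiffAt_alphaBeta ha hb hf hg k hp.1 hp.2).contDiffWithinAt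
  pos := hpos
  homogeneous x hx y r hr := by
    rcases eq_or_ne y 0 with rfl | hy
    · simp [h0 x hx]
    have hr0 : r • y ≠ 0 := smul_ne_zero hr.ne' hy
    have hs : 0 < √(a x y y) := Real.sqrt_pos.2 (ha.pos x hx y hy)
    rw [h x hx y hy, h x hx _ hr0]
    simp only [alphaBeta, map_smul, smul_apply, smul_eq_mul]
    rw [← mul_assoc, Real.sqrt_mul (by positivity), Real.sqrt_mul_self hr.le]
    field_simp
  isUnit_det x hx y hy := (hdet x hx y hy).det_pos.ne'.isUnit

/-- Half of α² is a quadratic form in y, so its Hessian is the metric matrix itself. -/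
theorem posDef_fundamentalTensor_sqrt (ha : IsMetricOn a U) (hx : x ∈ U) (y : Coord n) :
    (fundamentalTensor (fun x y => √(a x y y)) x y).PosDef := by
  convert posDef_metricMatrix ha hx using 1
  ext i j
  have h1 : (fun z => (1 / 2 : ℝ) * √(a x z z) ^ 2) = fun z => (1 / 2 : ℝ) * a x z z := by
    ext z; rw [Real.sq_sqrt (ha.nonneg hx z)]
  have h2 : ∀ w : Coord n, partialDeriv i (fun z => (1 / 2 : ℝ) * a x z z) w
      = a x (EuclideanSpace.single i 1) w := by
    intro w
    have := ((a x).hasFDerivAt.clm_apply (hasFDerivAt_id w)).fderiv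
    rw [partialDeriv_const_mul, partialDeriv]
    simp only [id] at this
    rw [this]
    simp [ha.symm x hx w]
    ring
  simp only [fundamentalTensor, Matrix.of_apply, metricMatrix, h1, h2]
  rw [partialDeriv, ContinuousLinearMap.fderiv]

theorem isSlitFinsler_sqrt (ha : IsMetricOn a U) :
    IsSlitFinsler (fun x y => √(a x y y)) U := by
  refine isSlitFinsler_of_eq_alphaBeta (b := fun _ => 0) (f := fun _ => 1) (g := fun _ => 0)
    (k := 0) ha contDiffOn_const contDiffOn_const contDiffOn_const (fun x hx y hy => ?_)
    (fun x hx => ?_) (fun x hx y hy => Real.sqrt_pos.2 (ha.pos x hx y hy))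
    fun x hx y hy => posDef_fundamentalTensor_sqrt ha hx y
  · simp [alphaBeta]
  · simp

end SqrtMetric

/-! ### Metrics, forms and norms in charts. -/

section Charts

variable {M : Type*} [TopologicalSpace M] [ChartedSpace (Coord n) M]
  {e e' : OpenPartialHomeomorph M (Coord n)} {u : Coord n}

theorem mdifferentiable_chart (he : e ∈ IsManifold.maximalAtlas (𝓡 n) ∞ M) :
    e.MDifferentiable (𝓡 n) (𝓡 n) :=
  ⟨(contMDiffOn_of_mem_maximalAtlas he).mdifferentiableOn (by simp),
    (contMDiffOn_symm_of_mem_maximalAtlas he).mdifferentiableOn (by simp)⟩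

/-- The derivative of the inverse of a chart, as a linear map of the model space. -/
def chartDeriv (e : OpenPartialHomeomorph M (Coord n)) (u : Coord n) : Coord n →L[ℝ] Coord n :=
  mfderiv (𝓡 n) (𝓡 n) e.symm u

theorem chartDeriv_injective (he : e ∈ IsManifold.maximalAtlas (𝓡 n) ∞ M) (hu : u ∈ e.target) :
    Function.Injective (chartDeriv e u) :=
  (mdifferentiable_chart he).symm.mfderiv_injective hu

theorem chartDeriv_surjective (he : e ∈ IsManifold.maximalAtlas (𝓡 n) ∞ M) (hu : u ∈ e.target) :
    Function.Surjective (chartDeriv e u) :=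
  (mdifferentiable_chart he).symm.mfderiv_surjective hu

variable [IsManifold (𝓡 n) ∞ M]

/-- A Riemannian metric at a point, as a bilinear form on the model space. -/
def RiemMetric.form (α : RiemMetric n M) (x : M) : Coord n →L[ℝ] Coord n →L[ℝ] ℝ :=
  α.inner x

/-- A 1-form at a point, as a linear function on the model space. -/
def OneForm.form (β : OneForm n M) (x : M) : Coord n →L[ℝ] ℝ :=
  β x

/-- A Riemannian metric in a chart. -/
def RiemMetric.inChart (α : RiemMetric n M) (e : OpenPartialHomeomorph M (Coord n))
    (u : Coord n) : Coord n →L[ℝ] Coord n →L[ℝ] ℝ :=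
  (α.form (e.symm u)).bilinearComp (chartDeriv e u) (chartDeriv e u)

/-- A 1-form in a chart. -/
def OneForm.inChart (β : OneForm n M) (e : OpenPartialHomeomorph M (Coord n))
    (u : Coord n) : Coord n →L[ℝ] ℝ :=
  (β.form (e.symm u)).comp (chartDeriv e u)

theorem RiemMetric.inChart_apply (α : RiemMetric n M) (v w : Coord n) :
    α.inChart e u v w = α.inner (e.symm u) (chartVector e u v) (chartVector e u w) := rfl

theorem OneForm.inChart_apply (β : OneForm n M) (v : Coord n) :
    β.inChart e u v = β.val (e.symm u) (chartVector e u v) := rfl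

/-- The field is the tangent map of the inverse chart composed with the constant field v. -/
theorem contMDiffOn_chartVector (he : e ∈ IsManifold.maximalAtlas (𝓡 n) ∞ M) (v : Coord n) :
    ContMDiffOn (𝓡 n) ((𝓡 n).prod 𝓘(ℝ, Coord n)) ∞
      (fun u => (⟨e.symm u, chartVector e u v⟩ : TangentBundle (𝓡 n) M)) e.target := by
  have h1 := (contMDiffOn_symm_of_mem_maximalAtlas he).contMDiffOn_tangentMapWithin (m := ∞)
    (by simp) e.open_target.uniqueMDiffOn
  have h2 : ContMDiff (𝓡 n) (𝓡 n).tangent ∞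
      (fun u : Coord n => (⟨u, v⟩ : TangentBundle (𝓡 n) (Coord n))) :=
    contMDiff_vectorSpace_iff_contDiff.2 contDiff_const
  refine (h1.comp h2.contMDiffOn fun u hu => hu).congr fun u hu => ?_
  simp only [Function.comp_apply, tangentMapWithin, chartVector]
  rw [mfderivWithin_of_isOpen e.open_target hu]

theorem RiemMetric.contDiffOn_inChart (α : RiemMetric n M)
    (he : e ∈ IsManifold.maximalAtlas (𝓡 n) ∞ M) : ContDiffOn ℝ ∞ (α.inChart e) e.target := by
  simp only [contDiffOn_clm_apply]
  intro v w
  rw [← contMDiffOn_iff_contDiffOn]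
  intro u hu
  have h1 : ContMDiffWithinAt (𝓡 n) ((𝓡 n).prod 𝓘(ℝ)) ∞
      (fun z => Bundle.TotalSpace.mk' ℝ (E := Bundle.Trivial M ℝ) (e.symm z)
        (α.inner (e.symm z) (chartVector e z v) (chartVector e z w))) e.target u := by
    apply ContMDiffWithinAt.clm_bundle_apply₂ (F₁ := Coord n) (F₂ := Coord n)
    · exact α.contMDiff.contMDiffAt.comp_contMDiffWithinAt u
        (contMDiffOn_symm_of_mem_maximalAtlas he u hu)
    · exact contMDiffOn_chartVector he v u hu
    · exact contMDiffOn_chartVector he w u hu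
  simp only [Bundle.contMDiffWithinAt_totalSpace] at h1
  exact h1.2

theorem OneForm.contDiffOn_inChart (β : OneForm n M)
    (he : e ∈ IsManifold.maximalAtlas (𝓡 n) ∞ M) : ContDiffOn ℝ ∞ (β.inChart e) e.target := by
  simp only [contDiffOn_clm_apply]
  intro v
  rw [← contMDiffOn_iff_contDiffOn]
  intro u hu
  have h1 : ContMDiffWithinAt (𝓡 n) ((𝓡 n).prod 𝓘(ℝ)) ∞
      (fun z => Bundle.TotalSpace.mk' ℝ (E := Bundle.Trivial M ℝ) (e.symm z)
        (β (e.symm z) (chartVector e z v))) e.target u := by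
    apply ContMDiffWithinAt.clm_bundle_apply (F₁ := Coord n)
    · exact β.contMDiff.contMDiffAt.comp_contMDiffWithinAt u
        (contMDiffOn_symm_of_mem_maximalAtlas he u hu)
    · exact contMDiffOn_chartVector he v u hu
  simp only [Bundle.contMDiffWithinAt_totalSpace] at h1
  exact h1.2

theorem RiemMetric.isMetricOn (α : RiemMetric n M) (he : e ∈ IsManifold.maximalAtlas (𝓡 n) ∞ M) :
    IsMetricOn (α.inChart e) e.target where
  isOpen := e.open_target
  smooth := α.contDiffOn_inChart he
  symm _ _ _ _ := α.symm _ _ _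
  pos u hu v hv := by
    have hne : chartDeriv e u v ≠ 0 :=
      (map_ne_zero_iff _ (chartDeriv_injective he hu)).2 hv
    exact α.pos (e.symm u) (chartVector e u v) hne

theorem RiemMetric.val_chart (α : RiemMetric n M) (v : Coord n) :
    α.val (e.symm u) (chartVector e u v) = √(α.inChart e u v v) := rfl

/-- Cauchy–Schwarz bounds every quotient, and b^♯ attains the bound; if b = 0 this is still true
through 0/0 = 0. -/
theorem dualNorm_symm (α : RiemMetric n M) (β : OneForm n M)
    (he : e ∈ IsManifold.maximalAtlas (𝓡 n) ∞ M) (hu : u ∈ e.target) :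
    dualNorm α β (e.symm u) = √(normSq (α.inChart e) (β.inChart e) u) := by
  have ha := α.isMetricOn he
  have hle : ∀ y : TangentSpace (𝓡 n) (e.symm u), β.val (e.symm u) y / α.val (e.symm u) y
      ≤ √(normSq (α.inChart e) (β.inChart e) u) := by
    intro y
    obtain ⟨v, rfl⟩ := chartDeriv_surjective he hu y
    change β.inChart e u v / √(α.inChart e u v v) ≤ _
    refine div_le_of_le_mul₀ (Real.sqrt_nonneg _) (Real.sqrt_nonneg _) ?_
    rw [← Real.sqrt_mul (ha.normSq_nonneg hu)]
    exact Real.le_sqrt_of_sq_le (ha.cauchy_schwarz hu v)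
  refine le_antisymm (ciSup_le hle) ?_
  have h1 := le_ciSup (f := fun y : TangentSpace (𝓡 n) (e.symm u) =>
    β.val (e.symm u) y / α.val (e.symm u) y) ⟨_, by rintro _ ⟨y, rfl⟩; exact hle y⟩
    (chartVector e u (sharp (α.inChart e) (β.inChart e) u))
  refine le_trans (le_of_eq ?_) h1
  change _ = β.inChart e u _ / √(α.inChart e u _ _)
  rw [ha.apply_sharp_left hu]
  change _ = normSq (α.inChart e) (β.inChart e) u / √(normSq (α.inChart e) (β.inChart e) u)
  rw [Real.div_sqrt]

theorem dualNorm_sq_symm (α : RiemMetric n M) (β : OneForm n M)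
    (he : e ∈ IsManifold.maximalAtlas (𝓡 n) ∞ M) (hu : u ∈ e.target) :
    dualNorm α β (e.symm u) ^ 2 = normSq (α.inChart e) (β.inChart e) u := by
  rw [dualNorm_symm α β he hu, Real.sq_sqrt ((α.isMetricOn he).normSq_nonneg hu)]

/-- The square is used because the norm itself need not be smooth at zeros of β. -/
theorem contMDiff_dualNorm_sq (α : RiemMetric n M) (β : OneForm n M) :
    ContMDiff (𝓡 n) 𝓘(ℝ, ℝ) ∞ fun x => dualNorm α β x ^ 2 := by
  intro x
  have he := IsManifold.chart_mem_maximalAtlas (I := 𝓡 n) (n := ∞) x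
  have hx := mem_chart_source (Coord n) x
  set e := chartAt (Coord n) x
  have h1 := ((α.isMetricOn he).contDiffOn_normSq (β.contDiffOn_inChart he)).contMDiffOn
  have h2 := (h1.contMDiffAt (e.open_target.mem_nhds (e.map_source hx))).comp x
    (contMDiffAt_of_mem_maximalAtlas he hx)
  refine h2.congr_of_eventuallyEq ?_
  filter_upwards [e.open_source.mem_nhds hx] with z hz
  rw [Function.comp_apply, ← dualNorm_sq_symm α β he (e.map_source hz), e.left_inv hz]

theorem dualNorm_nonneg (α : RiemMetric n M) (β : OneForm n M) (x : M) : 0 ≤ dualNorm α β x := by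
  have he := IsManifold.chart_mem_maximalAtlas (I := 𝓡 n) (n := ∞) x
  have hx := mem_chart_source (Coord n) x
  rw [← (chartAt (Coord n) x).left_inv hx,
    dualNorm_symm α β he ((chartAt (Coord n) x).map_source hx)]
  exact Real.sqrt_nonneg _

/-- A conformal rescaling of a Riemannian metric. -/
def RiemMetric.rescale (α : RiemMetric n M) (f : M → ℝ) (hf : ContMDiff (𝓡 n) 𝓘(ℝ, ℝ) ∞ f)
    (hpos : ∀ x, 0 < f x) : RiemMetric n M where
  inner x := f x • α.inner x
  symm x v w := congrArg (f x * ·) (α.symm x v w)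
  pos x v hv := mul_pos (hpos x) (α.pos x v hv)
  isVonNBounded x := by
    -- The unit ball of f·a is contained in the image of that of a under scaling by 1/√f.
    have h := (α.isVonNBounded x).image
      ((√(f x))⁻¹ • ContinuousLinearMap.id ℝ (TangentSpace (𝓡 n) x))
    refine Bornology.IsVonNBounded.subset ?_ h
    intro v hv
    refine ⟨√(f x) • v, ?_, ?_⟩
    · have hv' : f x * α.inner x v v < 1 := hv
      have h2 : √(f x) * √(f x) = f x := Real.mul_self_sqrt (hpos x).le
      simp only [Set.mem_ofPred_eq, map_smul, smul_apply, smul_eq_mul, ← mul_assoc, h2]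
      exact hv'
    · have h3 : √(f x) ≠ 0 := (Real.sqrt_pos.2 (hpos x)).ne'
      simp [smul_smul, mul_inv_cancel₀ h3]
  contMDiff := hf.smul_section α.contMDiff

/-- The product of a 1-form with a smooth function. -/
def OneForm.rescale (β : OneForm n M) (f : M → ℝ) (hf : ContMDiff (𝓡 n) 𝓘(ℝ, ℝ) ∞ f) :
    OneForm n M :=
  ⟨fun x => f x • β x, hf.smul_section β.contMDiff⟩

end Charts

/-! ### Independence of the chart. -/

section Transition

variable {M : Type*} [TopologicalSpace M]
  {e e' : OpenPartialHomeomorph M (Coord n)} {u : Coord n}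

/-- The domain of the transition map from the chart `e'` to the chart `e`. -/
def transitionDomain (e e' : OpenPartialHomeomorph M (Coord n)) : Set (Coord n) :=
  e'.target ∩ e'.symm ⁻¹' e.source

theorem isOpen_transitionDomain : IsOpen (transitionDomain e e') :=
  e'.isOpen_inter_preimage_symm e.open_source

theorem mapsTo_transition : Set.MapsTo (e ∘ e'.symm) (transitionDomain e e') e.target :=
  fun _ hz => e.map_source hz.2

variable [ChartedSpace (Coord n) M]

theorem contDiffOn_transition (he : e ∈ IsManifold.maximalAtlas (𝓡 n) ∞ M)
    (he' : e' ∈ IsManifold.maximalAtlas (𝓡 n) ∞ M) :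
    ContDiffOn ℝ ∞ (e ∘ e'.symm) (transitionDomain e e') := by
  rw [← contMDiffOn_iff_contDiffOn]
  exact (contMDiffOn_of_mem_maximalAtlas he).comp
    ((contMDiffOn_symm_of_mem_maximalAtlas he').mono Set.inter_subset_left) fun z hz => hz.2

theorem chartDeriv_transition (he : e ∈ IsManifold.maximalAtlas (𝓡 n) ∞ M)
    (he' : e' ∈ IsManifold.maximalAtlas (𝓡 n) ∞ M) (hu : u ∈ transitionDomain e e')
    (v : Coord n) :
    chartDeriv e' u v = chartDeriv e ((e ∘ e'.symm) u) (fderiv ℝ (e ∘ e'.symm) u v) := by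
  have hev : e'.symm =ᶠ[𝓝 u] e.symm ∘ (e ∘ e'.symm) := by
    filter_upwards [isOpen_transitionDomain.mem_nhds hu] with z hz
    exact (e.left_inv hz.2).symm
  have h1 : MDifferentiableAt (𝓡 n) (𝓡 n) e.symm ((e ∘ e'.symm) u) :=
    (mdifferentiable_chart he).mdifferentiableAt_symm (mapsTo_transition hu)
  have h2 : MDifferentiableAt (𝓡 n) (𝓡 n) (e ∘ e'.symm) u :=
    (hasFDerivAt_of_contDiffOn isOpen_transitionDomain (contDiffOn_transition he he')
      hu).differentiableAt.mdifferentiableAt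
  have h3 := mfderiv_comp u h1 h2
  have h4 : chartDeriv e' u = mfderiv (𝓡 n) (𝓡 n) (e.symm ∘ (e ∘ e'.symm)) u := hev.mfderiv_eq
  rw [h4, h3, mfderiv_eq_fderiv]
  rfl

variable [IsManifold (𝓡 n) ∞ M]

theorem RiemMetric.inChart_transition (α : RiemMetric n M)
    (he : e ∈ IsManifold.maximalAtlas (𝓡 n) ∞ M)
    (he' : e' ∈ IsManifold.maximalAtlas (𝓡 n) ∞ M) (hu : u ∈ transitionDomain e e')
    (v w : Coord n) :
    α.inChart e' u v w = α.inChart e ((e ∘ e'.symm) u) (fderiv ℝ (e ∘ e'.symm) u v)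
      (fderiv ℝ (e ∘ e'.symm) u w) := by
  have h : e.symm ((e ∘ e'.symm) u) = e'.symm u := e.left_inv hu.2
  simp only [RiemMetric.inChart, ContinuousLinearMap.bilinearComp_apply, h,
    chartDeriv_transition he he' hu]

theorem OneForm.inChart_transition (β : OneForm n M)
    (he : e ∈ IsManifold.maximalAtlas (𝓡 n) ∞ M)
    (he' : e' ∈ IsManifold.maximalAtlas (𝓡 n) ∞ M) (hu : u ∈ transitionDomain e e')
    (v : Coord n) :
    β.inChart e' u v = β.inChart e ((e ∘ e'.symm) u) (fderiv ℝ (e ∘ e'.symm) u v) := by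
  have h : e.symm ((e ∘ e'.symm) u) = e'.symm u := e.left_inv hu.2
  simp only [OneForm.inChart, ContinuousLinearMap.comp_apply, h,
    chartDeriv_transition he he' hu]

/-- Closedness of a 1-form is independent of the chart. -/
theorem OneForm.closed_transition (β : OneForm n M)
    (he : e ∈ IsManifold.maximalAtlas (𝓡 n) ∞ M)
    (he' : e' ∈ IsManifold.maximalAtlas (𝓡 n) ∞ M) (hu : u ∈ transitionDomain e e')
    (h : ∀ v w, fderiv ℝ (β.inChart e) ((e ∘ e'.symm) u) v w
      = fderiv ℝ (β.inChart e) ((e ∘ e'.symm) u) w v) (v w : Coord n) :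
    fderiv ℝ (β.inChart e') u v w = fderiv ℝ (β.inChart e') u w v := by
  have hφ := contDiffOn_transition he he'
  have hsymm := ((hφ.contDiffAt (isOpen_transitionDomain.mem_nhds hu)).isSymmSndFDerivAt
    (by simp; norm_cast)).eq
  have hd := (hasFDerivAt_of_contDiffOn e'.open_target (β.contDiffOn_inChart he')
    hu.1).differentiableAt
  have hp := fderiv_pullback_form e.open_target (β.contDiffOn_inChart he) isOpen_transitionDomain
    hφ mapsTo_transition (fun z hz v => β.inChart_transition he he' hz v) hd hu
  rw [hp, hp, h, hsymm v w]

/-- The symmetrized covariant derivative is independent of the chart. -/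
theorem covSym_transition (α : RiemMetric n M) (β : OneForm n M)
    (he : e ∈ IsManifold.maximalAtlas (𝓡 n) ∞ M)
    (he' : e' ∈ IsManifold.maximalAtlas (𝓡 n) ∞ M) (hu : u ∈ transitionDomain e e')
    (v w : Coord n) :
    covSym (α.inChart e') (β.inChart e') u v w =
      covSym (α.inChart e) (β.inChart e) ((e ∘ e'.symm) u) (fderiv ℝ (e ∘ e'.symm) u v)
        (fderiv ℝ (e ∘ e'.symm) u w) := by
  have ha' := α.isMetricOn he'
  have hs : transitionDomain e e' ⊆ e'.target := Set.inter_subset_left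
  exact covSym_pullback (α.isMetricOn he)
    ⟨isOpen_transitionDomain, ha'.smooth.mono hs, fun x hx => ha'.symm x (hs hx),
      fun x hx => ha'.pos x (hs hx)⟩
    (β.contDiffOn_inChart he) ((β.contDiffOn_inChart he').mono hs)
    (contDiffOn_transition he he') mapsTo_transition
    (fun z hz v w => α.inChart_transition he he' hz v w)
    (fun z hz v => β.inChart_transition he he' hz v) hu v w

theorem OneForm.isClosed_iff (β : OneForm n M) :
    β.IsClosed ↔ ∀ e ∈ IsManifold.maximalAtlas (𝓡 n) ∞ M, ∀ u ∈ e.target, ∀ v w,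
      fderiv ℝ (β.inChart e) u v w = fderiv ℝ (β.inChart e) u w v :=
  forall₂_congr fun e he => forall₂_congr fun _ hu =>
    forall_closed_iff e.open_target (β.contDiffOn_inChart he) hu

theorem OneForm.isConformal_iff (β : OneForm n M) (α : RiemMetric n M) :
    β.IsConformal α ↔ ∃ c : M → ℝ, ∀ e ∈ IsManifold.maximalAtlas (𝓡 n) ∞ M, ∀ u ∈ e.target,
      ∀ v w, covSym (α.inChart e) (β.inChart e) u v w = c (e.symm u) * α.inChart e u v w :=
  exists_congr fun c => forall₂_congr fun e he => forall₂_congr fun u hu =>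
    forall_conformal_iff (α.isMetricOn he) (β.contDiffOn_inChart he) hu (c (e.symm u))

/-- A 1-form is closed if it is closed in some chart around every point. -/
theorem OneForm.isClosed_of_exists (β : OneForm n M)
    (h : ∀ p : M, ∃ e ∈ IsManifold.maximalAtlas (𝓡 n) ∞ M, p ∈ e.source ∧ ∀ v w,
      fderiv ℝ (β.inChart e) (e p) v w = fderiv ℝ (β.inChart e) (e p) w v) : β.IsClosed := by
  rw [OneForm.isClosed_iff]
  intro e' he' u hu
  obtain ⟨e, he, hp, hcl⟩ := h (e'.symm u)
  exact β.closed_transition he he' ⟨hu, hp⟩ hcl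

/-- A 1-form is conformal if it is conformal in some chart around every point. -/
theorem OneForm.isConformal_of_exists (β : OneForm n M) (α : RiemMetric n M)
    (h : ∀ p : M, ∃ e ∈ IsManifold.maximalAtlas (𝓡 n) ∞ M, p ∈ e.source ∧ ∃ c : ℝ, ∀ v w,
      covSym (α.inChart e) (β.inChart e) (e p) v w = c * α.inChart e (e p) v w) :
    β.IsConformal α := by
  rw [OneForm.isConformal_iff]
  -- The factor is chosen point by point, each in its own chart; it is a scalar, so the
  -- transformation law makes it valid in every other chart at that point.
  choose e he hp c hc using h
  refine ⟨c, fun e' he' u hu v w => ?_⟩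
  have hmem : u ∈ transitionDomain (e (e'.symm u)) e' := ⟨hu, hp _⟩
  rw [covSym_transition α β (he _) he' hmem, α.inChart_transition (he _) he' hmem]
  exact hc _ _ _

end Transition

/-! ### Berwald's metric on the manifold. -/

section Main

variable {M : Type*} [TopologicalSpace M] [ChartedSpace (Coord n) M] [IsManifold (𝓡 n) ∞ M]
  {e : OpenPartialHomeomorph M (Coord n)} {u : Coord n}
  {α α' : RiemMetric n M} {β β' : OneForm n M}

theorem inChart_val_eq (α : RiemMetric n M) (e : OpenPartialHomeomorph M (Coord n)) :
    inChart α.val e = fun u v => √(α.inChart e u v v) := rfl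

theorem inChart_berwaldMetric (α : RiemMetric n M) (β : OneForm n M)
    (e : OpenPartialHomeomorph M (Coord n)) (u v : Coord n) :
    inChart (berwaldMetric α β) e u v =
      (√(α.inChart e u v v) + β.inChart e u v) ^ 2 / √(α.inChart e u v v) := rfl

theorem inChart_berwaldMetric_eq_alphaBeta (α : RiemMetric n M) (β : OneForm n M)
    (he : e ∈ IsManifold.maximalAtlas (𝓡 n) ∞ M) (hu : u ∈ e.target) {v : Coord n} (hv : v ≠ 0) :
    inChart (berwaldMetric α β) e u v =
      alphaBeta (α.inChart e) (β.inChart e) (fun _ => 1) (fun _ => 2) 1 u v := by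
  have hs := Real.sqrt_pos.2 ((α.isMetricOn he).pos u hu v hv)
  rw [inChart_berwaldMetric, alphaBeta]
  field_simp
  ring

theorem isSlitFinsler_berwaldMetric (hF : IsFinsler (berwaldMetric α β))
    (hb : ∀ x : M, dualNorm α β x < 1) (he : e ∈ IsManifold.maximalAtlas (𝓡 n) ∞ M) :
    IsSlitFinsler (inChart (berwaldMetric α β) e) e.target := by
  have ha := α.isMetricOn he
  refine isSlitFinsler_of_eq_alphaBeta ha (β.contDiffOn_inChart he)
    (contDiffOn_const (c := (1 : ℝ))) (contDiffOn_const (c := (2 : ℝ))) (k := 1)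
    (fun u hu v hv => inChart_berwaldMetric_eq_alphaBeta α β he hu hv)
    (fun u hu => ?_) (fun u hu v hv => ?_) (fun u hu v hv => hF.convex e he u hu v hv)
  · simp [inChart_berwaldMetric]
  · have hs := Real.sqrt_pos.2 (ha.pos u hu v hv)
    rw [inChart_berwaldMetric]
    -- The bound ‖β‖ < 1 gives |β| < α, hence α + β > 0.
    have h1 : |β.inChart e u v| < √(α.inChart e u v v) := by
      have h2 := hb (e.symm u)
      rw [dualNorm_symm α β he hu] at h2
      calc |β.inChart e u v|
          ≤ √(normSq (α.inChart e) (β.inChart e) u) * √(α.inChart e u v v) := by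
            rw [← Real.sqrt_mul (ha.normSq_nonneg hu)]
            exact Real.abs_le_sqrt (ha.cauchy_schwarz hu v)
        _ < 1 * √(α.inChart e u v v) := by gcongr
        _ = _ := one_mul _
    have h3 := (abs_lt.1 h1).1
    have : 0 < √(α.inChart e u v v) + β.inChart e u v := by linarith
    positivity

theorem normSq_inChart_lt_one (hb : ∀ x : M, dualNorm α β x < 1)
    (he : e ∈ IsManifold.maximalAtlas (𝓡 n) ∞ M) :
    ∀ u ∈ e.target, normSq (α.inChart e) (β.inChart e) u < 1 := by
  intro u hu
  rw [← dualNorm_sq_symm α β he hu]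
  have h1 := hb (e.symm u)
  have h2 := dualNorm_nonneg α β (e.symm u)
  nlinarith

/-- The representation of Berwald's metric by deformation data. -/
theorem IsDeformationData.berwaldMetric_eq (h : IsDeformationData α β α' β') (x : M)
    (y : TangentSpace (𝓡 n) x) :
    berwaldMetric α β x y =
      (√(1 + dualNorm α' β' x ^ 2) * α'.val x y + β'.val x y) ^ 2 / α'.val x y := by
  have hp : 0 < 1 + dualNorm α' β' x ^ 2 := by positivity
  have hs := Real.sq_sqrt hp.le
  have hsp := Real.sqrt_pos.2 hp
  rw [berwaldMetric, h.alpha_eq, h.beta_eq]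
  generalize √(1 + dualNorm α' β' x ^ 2) = s at hs hsp
  rw [← hs]
  rcases eq_or_ne (α'.val x y) 0 with h0 | h0
  · simp [h0]
  · field_simp

/-- Any chart straightening ᾱ also straightens F = (1 + b̄²)ᾱ + 2√(1 + b̄²)β̄ + β̄²/ᾱ. -/
theorem IsDeformationData.isLocallyProjectivelyFlat (h : IsDeformationData α β α' β')
    (hF : IsFinsler (berwaldMetric α β)) (hb : ∀ x : M, dualNorm α β x < 1) :
    IsLocallyProjectivelyFlat (berwaldMetric α β) := by
  intro p
  obtain ⟨e, he, hp, hs⟩ := h.flat p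
  refine ⟨e, he, hp, ?_⟩
  have ha' := α'.isMetricOn he
  have hb' := β'.contDiffOn_inChart he
  rw [inChart_val_eq, (isSlitFinsler_sqrt ha').geodesicsAreStraight_iff] at hs
  rw [(isSlitFinsler_berwaldMetric hF hb he).geodesicsAreStraight_iff]
  intro u hu v hv w
  obtain ⟨c, hc⟩ := (β'.isConformal_iff α').1 h.conformal
  rw [← hamel_of_deformation ha' hb' hu (fun y hy w => ?_)
    (β'.isClosed_iff.1 h.closed e he u hu) (hc e he u hu) hv w]
  · refine hamel_congr e.open_target (fun x hx y hy => ?_) hu hv w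
    have hsq := Real.sqrt_pos.2 (ha'.pos x hx y hy)
    have hB := ha'.normSq_nonneg (b := β'.inChart e) hx
    have hB' := Real.sq_sqrt (show 0 ≤ 1 + normSq (α'.inChart e) (β'.inChart e) x by linarith)
    have h1 := h.berwaldMetric_eq (e.symm x) (chartVector e x y)
    rw [dualNorm_sq_symm α' β' he hx] at h1
    rw [inChart, h1, RiemMetric.val_chart, ← OneForm.inChart_apply, alphaBeta]
    field_simp
    rw [← hB']
    simp only [Real.sqrt_sq (Real.sqrt_nonneg _)]
    ring
  · refine (hamel_congr e.open_target (fun x hx y hy => ?_) hu hy w).trans (hs u hu y hy w)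
    simp [alphaBeta]

/-- Solving the required relations for the norm gives 1 − b² = 1/(1 + b̄²), which dictates ᾱ = (1 −
b²)α and β̄ = √(1 − b²)β. Their properties need checking only in charts that straighten F. -/
theorem exists_isDeformationData (hF : IsFinsler (berwaldMetric α β))
    (hb : ∀ x : M, dualNorm α β x < 1) (hflat : IsLocallyProjectivelyFlat (berwaldMetric α β)) :
    ∃ (α' : RiemMetric n M) (β' : OneForm n M), IsDeformationData α β α' β' := by
  have hpos : ∀ x, 0 < 1 - dualNorm α β x ^ 2 := fun x => by
    have h1 := hb x
    have h2 := dualNorm_nonneg α β x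
    nlinarith
  have hN : ContMDiff (𝓡 n) 𝓘(ℝ, ℝ) ∞ fun x => 1 - dualNorm α β x ^ 2 :=
    contMDiff_const.sub (contMDiff_dualNorm_sq α β)
  have hN2 : ContMDiff (𝓡 n) 𝓘(ℝ, ℝ) ∞ fun x => (1 - dualNorm α β x ^ 2) ^ 2 := hN.pow 2
  have hNs : ContMDiff (𝓡 n) 𝓘(ℝ, ℝ) ∞ fun x => √(1 - dualNorm α β x ^ 2) := fun x =>
    (Real.contDiffAt_sqrt (hpos x).ne').contMDiffAt.comp x (hN x)
  let α' : RiemMetric n M := α.rescale _ hN2 fun x => pow_pos (hpos x) 2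
  let β' : OneForm n M := β.rescale _ hNs
  have hα' : ∀ e ∈ IsManifold.maximalAtlas (𝓡 n) ∞ M, ∀ u ∈ e.target,
      α'.inChart e u = deformedMetric (α.inChart e) (β.inChart e) u := by
    intro e he u hu
    ext v w
    change (1 - dualNorm α β (e.symm u) ^ 2) ^ 2 * α.inChart e u v w = _
    rw [dualNorm_sq_symm α β he hu]
    rfl
  have hβ' : ∀ e ∈ IsManifold.maximalAtlas (𝓡 n) ∞ M, ∀ u ∈ e.target,
      β'.inChart e u = deformedForm (α.inChart e) (β.inChart e) u := by
    intro e he u hu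
    ext v
    change √(1 - dualNorm α β (e.symm u) ^ 2) * β.inChart e u v = _
    rw [dualNorm_sq_symm α β he hu]
    rfl
  have hdual : ∀ x, 1 + dualNorm α' β' x ^ 2 = (1 - dualNorm α β x ^ 2)⁻¹ := by
    intro x
    have he := IsManifold.chart_mem_maximalAtlas (I := 𝓡 n) (n := ∞) x
    have hx := mem_chart_source (Coord n) x
    set e := chartAt (Coord n) x
    have hu := e.map_source hx
    have hp := hpos x
    rw [← e.left_inv hx] at hp ⊢
    rw [dualNorm_sq_symm α β he hu] at hp ⊢
    have h1 : normSq (α'.inChart e) (β'.inChart e) (e x)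
        = normSq (deformedMetric (α.inChart e) (β.inChart e))
          (deformedForm (α.inChart e) (β.inChart e)) (e x) := by
      simp only [normSq, sharp, hα' e he _ hu, hβ' e he _ hu]
    rw [dualNorm_sq_symm α' β' he hu, h1, normSq_deformed (α.isMetricOn he)
      (β.contDiffOn_inChart he) (normSq_inChart_lt_one hb he) hu]
    field_simp
    ring
  have key : ∀ e ∈ IsManifold.maximalAtlas (𝓡 n) ∞ M,
      GeodesicsAreStraight (inChart (berwaldMetric α β) e) e.target → ∀ u ∈ e.target,
      (∀ y ≠ 0, ∀ w, hamel (inChart α'.val e) u y w = 0) ∧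
      (∀ v w, fderiv ℝ (β'.inChart e) u v w = fderiv ℝ (β'.inChart e) u w v) ∧
      ∃ c : ℝ, ∀ v w, covSym (α'.inChart e) (β'.inChart e) u v w = c * α'.inChart e u v w := by
    intro e he hs u hu
    have hU := e.open_target.mem_nhds hu
    rw [(isSlitFinsler_berwaldMetric hF hb he).geodesicsAreStraight_iff] at hs
    have eα : α'.inChart e =ᶠ[𝓝 u] deformedMetric (α.inChart e) (β.inChart e) :=
      Filter.mem_of_superset hU fun z hz => hα' e he z hz
    have eβ : β'.inChart e =ᶠ[𝓝 u] deformedForm (α.inChart e) (β.inChart e) :=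
      Filter.mem_of_superset hU fun z hz => hβ' e he z hz
    have hH : ∀ x ∈ e.target, ∀ y ≠ 0, ∀ w, hamel
        (alphaBeta (α.inChart e) (β.inChart e) (fun _ => 1) (fun _ => 2) 1) x y w = 0 := by
      intro x hx y hy w
      rw [← hs x hx y hy w]
      exact hamel_congr e.open_target
        (fun x hx y hy => (inChart_berwaldMetric_eq_alphaBeta α β he hx hy).symm) hx hy w
    obtain ⟨h1, h2, c, h3⟩ := deformation_of_hamel (α.isMetricOn he) (β.contDiffOn_inChart he)
      (normSq_inChart_lt_one hb he) hH hu
    refine ⟨fun y hy w => ?_, fun v w => ?_, c, fun v w => ?_⟩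
    · rw [← h1 y hy w]
      refine hamel_congr e.open_target (fun x hx y hy => ?_) hu hy w
      have hlt := normSq_inChart_lt_one hb he x hx
      rw [inChart_val_eq]
      simp only [hα' e he x hx, deformedMetric, smul_apply, smul_eq_mul, alphaBeta, zero_mul,
        add_zero]
      rw [Real.sqrt_mul (by positivity), Real.sqrt_sq (by linarith)]
    · rw [eβ.fderiv_eq, h2]
    · have := h3 v w
      rw [hα' e he u hu]
      rw [← this]
      simp only [covSym, koszul, sharp, eα.fderiv_eq, eβ.fderiv_eq, eα.self_of_nhds,
        eβ.self_of_nhds]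
  refine ⟨α', β', ?_, ?_, ?_, ?_, ?_⟩
  · intro p
    obtain ⟨e, he, hp, hs⟩ := hflat p
    refine ⟨e, he, hp, ?_⟩
    rw [inChart_val_eq, (isSlitFinsler_sqrt (α'.isMetricOn he)).geodesicsAreStraight_iff]
    exact fun u hu => (key e he hs u hu).1
  · refine β'.isClosed_of_exists fun p => ?_
    obtain ⟨e, he, hp, hs⟩ := hflat p
    exact ⟨e, he, hp, (key e he hs (e p) (e.map_source hp)).2.1⟩
  · refine β'.isConformal_of_exists α' fun p => ?_
    obtain ⟨e, he, hp, hs⟩ := hflat p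
    exact ⟨e, he, hp, (key e he hs (e p) (e.map_source hp)).2.2⟩
  · intro x y
    have hp := hpos x
    have h1 : α'.val x y = (1 - dualNorm α β x ^ 2) * α.val x y := by
      change √((1 - dualNorm α β x ^ 2) ^ 2 * α.inner x y y) = _
      rw [Real.sqrt_mul (by positivity), Real.sqrt_sq hp.le]
      rfl
    rw [hdual, h1, inv_mul_cancel_left₀ hp.ne']
  · intro x y
    have hp := hpos x
    have h1 : β'.val x y = √(1 - dualNorm α β x ^ 2) * β.val x y := rfl
    rw [hdual, h1, Real.sqrt_inv, inv_mul_cancel_left₀ (Real.sqrt_pos.2 hp).ne']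

end Main

end Berwald

end

theorem theorem3p1 (n : ℕ) (M : Type*) [TopologicalSpace M]
    [ChartedSpace (Berwald.Coord n) M] [IsManifold (𝓡 n) ∞ M]
    (α : Berwald.RiemMetric n M) (β : Berwald.OneForm n M)
    (hF : Berwald.IsFinsler (Berwald.berwaldMetric α β))
    (hb : ∀ x : M, Berwald.dualNorm α β x < 1) :
    (Berwald.IsLocallyProjectivelyFlat (Berwald.berwaldMetric α β) ↔
      ∃ (α' : Berwald.RiemMetric n M) (β' : Berwald.OneForm n M),
        Berwald.IsDeformationData α β α' β') ∧
    ∀ (α' : Berwald.RiemMetric n M) (β' : Berwald.OneForm n M),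
      Berwald.IsDeformationData α β α' β' →
        ∀ (x : M) (y : TangentSpace (𝓡 n) x),
          Berwald.berwaldMetric α β x y =
            (Real.sqrt (1 + Berwald.dualNorm α' β' x ^ 2) * α'.val x y + β'.val x y) ^ 2
              / α'.val x y := by
  exact ⟨⟨Berwald.exists_isDeformationData hF hb,
    fun ⟨_, _, h⟩ => h.isLocallyProjectivelyFlat hF hb⟩, fun _ _ h => h.berwaldMetric_eq⟩
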